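/- Let $S$ be a field and $\Sigma$ an alphabet. A deterministic weighted real-time one-counter automaton (DWROCA) $\mathcal A=(Q,q_0,s_0,\delta_0,\delta_1,\eta)$ over $\Sigma$ and $S$ consists of a finite set of states $Q$, an initial state $q_0\in Q$, an initial weight $s_0\in S$, transition functions $\delta_0:Q\times\Sigma\to Q\times\{0,1\}\times S$ and $\delta_1:Q\times\Sigma\to Q\times\{-1,0,1\}\times S$, and an output function $\eta:Q\to S$ (a set $F$ of final states is the case where $\eta$ is the indicator function of $F$). Its size $|\mathcal A|$ is the number of its states. A configuration is a triple $(q,n,s)\in Q\times\mathbb N\times S$, and the initial configuration is $(q_0,0,s_0)$. Reading a letter $a$, the configuration $(q,n,s)$ moves to $(q',n+d,s\cdot r)$, where $(q',d,r)=\delta_0(q,a)$ if $n=0$ and $(q',d,r)=\delta_1(q,a)$ if $n>0$. If reading the word $w$ from a configuration $c$ leads to $(q,n,s)$, put $f(w,c)=s\cdot\eta(q)$. Let $\mathcal A_1,\mathcal A_2$ be two DWROCAs over the same $\Sigma$ and $S$, with initial configurations $\chi_0,\psi_0$, and let $K=|\mathcal A_1|+|\mathcal A_2|$. A witness is a word $w$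 with $f(w,\chi_0)\ne f(w,\psi_0)$; it is minimal if no witness is shorter. Let $P_1(K)=14K^6$, $P_2(K)=6K^4$ and $$P_3(K)=P_1(K)+2\bigl(K^2P_2(K)\bigr)^2+1 .$$ Then $P_3(K)=\mathcal O(K^{12})$, and if $\chi_0$ and $\psi_0$ are not equivalent (that is, a witness exists), then for every minimal witness $w$, all counter values of both automata in the pair of runs of $\mathcal A_1$ and $\mathcal A_2$ on $w$ from $\chi_0$ and $\psi_0$ (after each prefix of $w$, including the empty one and $w$ itself) are at most $P_3(K)$. -/

import Mathlib

/-- A deterministic weighted real-time one-counter automaton over the alphabet `Γ`, with weights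
in `S` and set of states `Q`. Every state has exactly one transition for each letter and each
outcome of the zero test: `δ₀ q a = (q', d, r)` is the transition taken when the counter is zero,
and `δ₁ q a = (q', d, r)` the one taken when it is positive. Here `q'` is the new state, `d` the
counter effect and `r` the weight of the transition. -/
structure DWROCA (Γ S Q : Type*) where
  initState : Q
  initWeight : S
  δ₀ : Q → Γ → Q × ℤ × S
  δ₁ : Q → Γ → Q × ℤ × S
  out : Q → S
  δ₀_effect : ∀ q a, (δ₀ q a).2.1 ∈ ({0, 1} : Set ℤ)
  δ₁_effect : ∀ q a, (δ₁ q a).2.1 ∈ ({-1, 0, 1} : Set ℤ)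

namespace DWROCA

variable {Γ S Q Q₁ Q₂ : Type*}

/-- A configuration: a control state, a counter value and the weight accumulated so far. -/
@[ext]
structure Config (S Q : Type*) where
  state : Q
  counter : ℕ
  weight : S

/-- The initial configuration: initial state, counter zero, initial weight. -/
def initConfig (A : DWROCA Γ S Q) : Config S Q := ⟨A.initState, 0, A.initWeight⟩

/-- The transition data (new state, counter effect, weight) used from `c` on reading `a`. -/
def trans (A : DWROCA Γ S Q) (c : Config S Q) (a : Γ) : Q × ℤ × S :=
  if c.counter = 0 then A.δ₀ c.state a else A.δ₁ c.state a

/-- The successor configuration of `c` on reading `a`. By `step_counter` below, `Int.toNat` never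
truncates here. -/
def step [Mul S] (A : DWROCA Γ S Q) (c : Config S Q) (a : Γ) : Config S Q where
  state := (A.trans c a).1
  counter := ((c.counter : ℤ) + (A.trans c a).2.1).toNat
  weight := c.weight * (A.trans c a).2.2

theorem step_counter [Mul S] (A : DWROCA Γ S Q) (c : Config S Q) (a : Γ) :
    ((A.step c a).counter : ℤ) = c.counter + (A.trans c a).2.1 := by
  have h : (0 : ℤ) ≤ c.counter + (A.trans c a).2.1 := by
    unfold trans
    split_ifs with h0
    · have := A.δ₀_effect c.state a
      simp only [Set.mem_insert_iff, Set.mem_singleton_iff] at this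
      omega
    · have := A.δ₁_effect c.state a
      simp only [Set.mem_insert_iff, Set.mem_singleton_iff] at this
      omega
  exact Int.toNat_of_nonneg h

/-- The configuration reached from `c` after reading the word `w`. -/
def run [Mul S] (A : DWROCA Γ S Q) (c : Config S Q) (w : List Γ) : Config S Q :=
  w.foldl A.step c

/-- The weight with which `w` is accepted from the configuration `c`: the weight accumulated along
the unique run, multiplied by the output weight of the last state. -/
def acceptWeight [Mul S] (A : DWROCA Γ S Q) (w : List Γ) (c : Config S Q) : S :=
  (A.run c w).weight * A.out (A.run c w).state

/-- Equivalence of a configuration of `A₁` and a configuration of `A₂`. -/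
def ConfigEquiv [Mul S] (A₁ : DWROCA Γ S Q₁) (A₂ : DWROCA Γ S Q₂)
    (χ : Config S Q₁) (ψ : Config S Q₂) : Prop :=
  ∀ w : List Γ, A₁.acceptWeight w χ = A₂.acceptWeight w ψ

/-- A witness (of non-equivalence) for a pair of configurations. -/
def IsWitness [Mul S] (A₁ : DWROCA Γ S Q₁) (A₂ : DWROCA Γ S Q₂)
    (χ : Config S Q₁) (ψ : Config S Q₂) (w : List Γ) : Prop :=
  A₁.acceptWeight w χ ≠ A₂.acceptWeight w ψ

/-- A minimal witness: a witness of smallest length. -/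
def IsMinimalWitness [Mul S] (A₁ : DWROCA Γ S Q₁) (A₂ : DWROCA Γ S Q₂)
    (χ : Config S Q₁) (ψ : Config S Q₂) (w : List Γ) : Prop :=
  IsWitness A₁ A₂ χ ψ w ∧ ∀ v : List Γ, IsWitness A₁ A₂ χ ψ v → w.length ≤ v.length

/-- The run-pair of `w` from the pair `(χ, ψ)`: `runPair A₁ A₂ χ ψ w i` is the pair of
configurations reached after the first `i` letters of `w`, for `0 ≤ i ≤ |w|`. -/
def runPair [Mul S] (A₁ : DWROCA Γ S Q₁) (A₂ : DWROCA Γ S Q₂)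
    (χ : Config S Q₁) (ψ : Config S Q₂) (w : List Γ) (i : ℕ) : Config S Q₁ × Config S Q₂ :=
  (A₁.run χ (w.take i), A₂.run ψ (w.take i))

/-- The size of an automaton is its number of states. -/
def size [Fintype Q] (_A : DWROCA Γ S Q) : ℕ := Fintype.card Q

/-- The size of the initial space. -/
def P₁ (K : ℕ) : ℕ := 14 * K ^ 6

/-- The thickness of the belts. -/
def P₂ (K : ℕ) : ℕ := 6 * K ^ 4

/-- The bound on the counter values. -/
def P₃ (K : ℕ) : ℕ := P₁ K + 2 * (K ^ 2 * P₂ K) ^ 2 + 1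

end DWROCA

/-! At positive counter values an automaton acts like a finite automaton. Call a configuration
special if, on words of length at most K, it differs from every scaled state of the finite automaton
`sumδ`; specialness forces a counter below K and a nonzero weight. Let w be a minimal witness of
length E + K. At position E at least one of the two runs is special: otherwise the last K letters
are read by two scaled states of `sumδ`, which has K states, and agreement on words shorter than K
makes these equivalent (`finVal_eq_of_short`). After a prefix shorter than E the two automata agree
on all words of length at most K, so both configurations are special or neither is (`InSync`).

Hence, as long as the total length stays below E, both configurations have the same distance to the
special ones. That distance is at least the counter minus K and at most K times the counter plus K^3
(`Hit.exists_short`), which ties the two counters linearly (`InSync.exists_common`).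

Suppose the first counter climbs very high. For each level take the last crossing before the peak
and the first one after it. Two levels with the same four states allow a cut on both slopes; the
first automaton still ends in a special configuration, so by synchronisation the second one must
follow with a shifted counter. If three levels have equal effect on the second counter, the cuts of
one gap, of the other and of both are shorter words on which the automata agree, and
multiplicativity of the weights gives agreement on w (`InSync.acceptWeight_eq_of_cuts`). Otherwise
the second counter vanishes before the descent is over, and the shifts of more than 3K^4 levels add
up to a violation of the linear tie. Once no hit can end before E, only linearly many letters in the
counter remain. The resulting bound is of order K^9, well within `P₃`. -/

namespace DWROCA

/-! ### Runs, accumulated weights and shifted counters -/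

section Runs

variable {Γ S Q : Type*}

/-- The factor of `w` between the positions `i` and `j`. -/
def seg (w : List Γ) (i j : ℕ) : List Γ := (w.take j).drop i

theorem seg_length (w : List Γ) {i j : ℕ} (hj : j ≤ w.length) : (seg w i j).length = j - i := by
  simp [seg, hj]

theorem take_append_seg (w : List Γ) {i j : ℕ} (hij : i ≤ j) :
    w.take i ++ seg w i j = w.take j := by
  have : w.take i = (w.take j).take i := by rw [List.take_take, min_eq_left hij]
  rw [this, seg, List.take_append_drop]

theorem seg_append_seg (w : List Γ) {i j k : ℕ} (hij : i ≤ j) (hjk : j ≤ k) :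
    seg w i j ++ seg w j k = seg w i k := by
  have h1 := take_append_seg w hij
  have h2 := take_append_seg w hjk
  have h3 := take_append_seg w (hij.trans hjk)
  rw [← h1, List.append_assoc, ← h3] at h2
  exact List.append_cancel_left h2

theorem seg_succ (w : List Γ) {i k : ℕ} (hik : i ≤ k) (hk : k < w.length) :
    seg w i (k + 1) = seg w i k ++ [w[k]] := by
  rw [← seg_append_seg w hik (Nat.le_succ k)]
  congr 1
  have h := take_append_seg w (Nat.le_succ k)
  rw [List.take_succ_eq_append_getElem hk] at h
  exact List.append_cancel_left h

theorem seg_self (w : List Γ) (i : ℕ) : seg w i i = [] := by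
  simp [seg]

variable [Field S] (A : DWROCA Γ S Q)

@[simp] theorem run_nil (c : Config S Q) : A.run c [] = c := rfl

@[simp] theorem run_cons (c : Config S Q) (a : Γ) (v : List Γ) :
    A.run c (a :: v) = A.run (A.step c a) v := rfl

theorem run_append (c : Config S Q) (v v' : List Γ) :
    A.run c (v ++ v') = A.run (A.run c v) v' := by
  simp [run, List.foldl_append]

theorem run_snoc (c : Config S Q) (v : List Γ) (a : Γ) :
    A.run c (v ++ [a]) = A.step (A.run c v) a := by
  simp [run_append]

theorem run_take_seg (c : Config S Q) (w : List Γ) {i j : ℕ} (hij : i ≤ j) :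
    A.run (A.run c (w.take i)) (seg w i j) = A.run c (w.take j) := by
  rw [← run_append, take_append_seg w hij]

theorem step_counter_le (c : Config S Q) (a : Γ) :
    (A.step c a).counter ≤ c.counter + 1 ∧ c.counter ≤ (A.step c a).counter + 1 := by
  have h := A.step_counter c a
  have : (A.trans c a).2.1 ∈ ({-1, 0, 1} : Set ℤ) := by
    unfold trans
    split_ifs
    · have := A.δ₀_effect c.state a
      simp only [Set.mem_insert_iff, Set.mem_singleton_iff] at this ⊢
      omega
    · exact A.δ₁_effect c.state a
  simp only [Set.mem_insert_iff, Set.mem_singleton_iff] at this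
  omega

theorem counter_take_succ (c : Config S Q) (w : List Γ) (i : ℕ) :
    (A.run c (w.take (i + 1))).counter ≤ (A.run c (w.take i)).counter + 1 ∧
      (A.run c (w.take i)).counter ≤ (A.run c (w.take (i + 1))).counter + 1 := by
  by_cases hi : i < w.length
  · rw [List.take_succ_eq_append_getElem hi, run_snoc]
    exact A.step_counter_le _ _
  · rw [List.take_of_length_le (by omega), List.take_of_length_le (by omega)]
    omega

theorem run_counter_le (c : Config S Q) (v : List Γ) :
    (A.run c v).counter ≤ c.counter + v.length ∧ c.counter ≤ (A.run c v).counter + v.length := by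
  induction v generalizing c with
  | nil => simp
  | cons a v ih =>
    have h1 := ih (A.step c a)
    have h2 := A.step_counter_le c a
    simp only [run_cons, List.length_cons]
    omega

/-- The product of the weights of the transitions used from `c` on reading `v`. -/
def factor (c : Config S Q) (v : List Γ) : S := (A.run ⟨c.state, c.counter, 1⟩ v).weight

/-- The transition depends only on the state and the outcome of the zero test, so a counter shift is
harmless while no test changes, and both weights acquire the same factor. -/
theorem step_shift {c D : Config S Q} (hs : D.state = c.state)
    (h0 : c.counter = 0 ↔ D.counter = 0) (a : Γ) :
    (A.step D a).state = (A.step c a).state ∧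
      ((A.step D a).counter : ℤ) = (A.step c a).counter + ((D.counter : ℤ) - c.counter) ∧
      ∃ r, (A.step D a).weight = D.weight * r ∧ (A.step c a).weight = c.weight * r := by
  have ht : A.trans D a = A.trans c a := by
    unfold trans
    rw [hs]
    by_cases h : c.counter = 0
    · rw [if_pos h, if_pos (h0.1 h)]
    · rw [if_neg h, if_neg (fun h' => h (h0.2 h'))]
  refine ⟨by simp [step, ht], ?_, (A.trans c a).2.2, by simp [step, ht], by simp [step]⟩
  rw [A.step_counter, A.step_counter, ht]
  ring

theorem run_same {c D : Config S Q} (hs : D.state = c.state) (hn : D.counter = c.counter)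
    (v : List Γ) :
    (A.run D v).state = (A.run c v).state ∧ (A.run D v).counter = (A.run c v).counter ∧
      (A.run D v).weight = D.weight * A.factor c v := by
  have key : ∀ (c D : Config S Q), D.state = c.state → D.counter = c.counter →
      (A.run D v).state = (A.run c v).state ∧ (A.run D v).counter = (A.run c v).counter ∧
      ∃ r, (A.run D v).weight = D.weight * r ∧ (A.run c v).weight = c.weight * r := by
    induction v with
    | nil => exact fun c D hs hn => ⟨hs, hn, 1, by simp, by simp⟩
    | cons a v ih =>
      intro c D hs hn
      obtain ⟨g1, g2, r, g3, g4⟩ := A.step_shift hs (by omega) a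
      obtain ⟨k1, k2, r', k3, k4⟩ := ih (A.step c a) (A.step D a) g1 (by omega)
      exact ⟨k1, k2, r * r', by rw [run_cons, k3, g3, mul_assoc],
        by rw [run_cons, k4, g4, mul_assoc]⟩
  refine ⟨(key c D hs hn).1, (key c D hs hn).2.1, ?_⟩
  obtain ⟨-, -, r, h1, h2⟩ := key ⟨c.state, c.counter, 1⟩ D hs hn
  rw [h1, factor, h2, one_mul]

theorem run_weight (c : Config S Q) (v : List Γ) :
    (A.run c v).weight = c.weight * A.factor c v := (A.run_same rfl rfl v).2.2

theorem factor_append (c : Config S Q) (v v' : List Γ) :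
    A.factor c (v ++ v') = A.factor c v * A.factor (A.run c v) v' := by
  have h := A.run_same (c := c) (D := ⟨c.state, c.counter, 1⟩) rfl rfl v
  unfold factor
  rw [run_append, (A.run_same h.1 h.2.1 v').2.2]
  rfl

/-- Two runs on the same factor of `w` that agree on all zero tests. -/
theorem run_resume (c₀ : Config S Q) (w : List Γ) {i : ℕ} {D : Config S Q} {δ : ℤ}
    (hs : D.state = (A.run c₀ (w.take i)).state)
    (hn : (D.counter : ℤ) = (A.run c₀ (w.take i)).counter + δ) {k : ℕ} (hik : i ≤ k)
    (hk : k ≤ w.length)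
    (h0 : ∀ l, i ≤ l → l < k → ((A.run c₀ (w.take l)).counter = 0 ↔
      ((A.run c₀ (w.take l)).counter : ℤ) + δ = 0)) :
    (A.run D (seg w i k)).state = (A.run c₀ (w.take k)).state ∧
      ((A.run D (seg w i k)).counter : ℤ) = (A.run c₀ (w.take k)).counter + δ ∧
      (A.run D (seg w i k)).weight =
        D.weight * A.factor (A.run c₀ (w.take i)) (seg w i k) := by
  induction k, hik using Nat.le_induction with
  | base => exact ⟨by simp [seg_self, hs], by simp [seg_self, hn], by simp [seg_self, factor]⟩
  | succ k hik ih =>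
    obtain ⟨h1, h2, h3⟩ := ih (by omega) fun l hl hl' => h0 l hl (by omega)
    have hz := h0 k hik (by omega)
    have hz' : (A.run c₀ (w.take k)).counter = 0 ↔ (A.run D (seg w i k)).counter = 0 := by omega
    obtain ⟨g1, g2, r, g3, -⟩ := A.step_shift h1 hz' w[k]
    rw [seg_succ w hik (by omega), run_snoc, List.take_succ_eq_append_getElem (by omega), run_snoc]
    refine ⟨g1, by omega, ?_⟩
    rw [factor_append, run_take_seg A c₀ w hik, ← mul_assoc, ← h3]
    simp only [factor, run_cons, run_nil, step, trans, one_mul, h1]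
    by_cases h : (A.run c₀ (w.take k)).counter = 0
    · rw [if_pos h, if_pos (by omega)]
    · rw [if_neg h, if_neg (by omega)]

end Runs

/-! ### Equivalence of states of weighted finite automata -/

section FiniteAutomata

variable {Γ S V : Type*}

/-- The weight with which the deterministic weighted finite automaton with transition function `δ`
and output function `η` accepts a word from the state `q` with weight one. -/
def finVal [Mul S] (δ : V → Γ → V × S) (η : V → S) : V → List Γ → S
  | q, [] => η q
  | q, a :: w => (δ q a).2 * finVal δ η (δ q a).1 w

variable [Field S] [Fintype V] (δ : V → Γ → V × S) (η : V → S)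

/-- The linear extension of `finVal` to vectors of weights. -/
noncomputable def pairing (w : List Γ) : (V → S) →ₗ[S] S :=
  ∑ q, finVal δ η q w • LinearMap.proj q

open Classical in
/-- The action of a letter on vectors of weights. -/
noncomputable def push (a : Γ) : (V → S) →ₗ[S] (V → S) :=
  ∑ q, (δ q a).2 • (LinearMap.single S (fun _ => S) (δ q a).1 ∘ₗ LinearMap.proj q)

theorem pairing_apply (w : List Γ) (v : V → S) :
    pairing δ η w v = ∑ q, finVal δ η q w * v q := by
  simp [pairing]

open Classical in
theorem pairing_single (w : List Γ) (q : V) (s : S) :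
    pairing δ η w (Pi.single q s) = finVal δ η q w * s := by
  rw [pairing_apply, Finset.sum_eq_single q]
  · simp
  · intro b _ hb
    simp [Pi.single_eq_of_ne hb]
  · simp

theorem pairing_cons (a : Γ) (w : List Γ) (v : V → S) :
    pairing δ η (a :: w) v = pairing δ η w (push δ a v) := by
  classical
  rw [push, LinearMap.sum_apply, map_sum, pairing_apply]
  refine Finset.sum_congr rfl fun q _ => ?_
  simp only [LinearMap.smul_apply, LinearMap.comp_apply, LinearMap.proj_apply, map_smul,
    LinearMap.coe_single, smul_eq_mul, finVal]
  rw [pairing_single]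
  ring

/-- The vectors that no word of length less than `k` distinguishes from zero. -/
noncomputable def annih (k : ℕ) : Submodule S (V → S) :=
  ⨅ w : {w : List Γ // w.length < k}, LinearMap.ker (pairing δ η w.1)

theorem mem_annih {k : ℕ} {v : V → S} :
    v ∈ annih δ η k ↔ ∀ w : List Γ, w.length < k → pairing δ η w v = 0 := by
  simp [annih, Submodule.mem_iInf]

theorem annih_anti {k l : ℕ} (h : k ≤ l) : annih δ η l ≤ annih δ η k := by
  intro v hv
  rw [mem_annih] at *
  exact fun w hw => hv w (by omega)

/-- A letter maps the vectors killed by words shorter than m + 1 into those killed by words shorter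
than m, so one equality in the descending chain propagates to all later terms. -/
theorem annih_stable {k : ℕ} (h : annih δ η k = annih δ η (k + 1)) (l : ℕ) :
    annih δ η k ≤ annih δ η (k + l) := by
  have step : ∀ m, annih δ η m = annih δ η (m + 1) → annih δ η (m + 1) ≤ annih δ η (m + 2) := by
    intro m hm v hv
    rw [mem_annih]
    intro w hw
    cases w with
    | nil => exact (mem_annih δ η).1 hv [] (by simp)
    | cons a w =>
      rw [pairing_cons]
      have hp : push δ a v ∈ annih δ η m := by
        rw [mem_annih]
        intro w' hw'
        rw [← pairing_cons]
        exact (mem_annih δ η).1 hv _ (by simpa using hw')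
      rw [hm] at hp
      exact (mem_annih δ η).1 hp w (by simpa using hw)
  have key : ∀ l, annih δ η (k + l) = annih δ η (k + l + 1) := by
    intro l
    induction l with
    | zero => exact h
    | succ l ih => exact le_antisymm (step _ ih) (annih_anti δ η (by omega))
  induction l with
  | zero => exact le_rfl
  | succ l ih => exact ih.trans (key l).le

/-- Each strict inclusion lowers the dimension, which starts at no more than the number of states.
-/
theorem exists_annih_eq : ∃ k ≤ Fintype.card V, annih δ η k = annih δ η (k + 1) := by
  by_contra! hne
  have key : ∀ k ≤ Fintype.card V + 1,
      Module.finrank S (annih δ η k) + k ≤ Fintype.card V := by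
    intro k
    induction k with
    | zero =>
      intro _
      simpa using (annih δ η 0).finrank_le
    | succ k ih =>
      intro hk
      have h1 := ih (by omega)
      have h2 : annih δ η (k + 1) < annih δ η k :=
        lt_of_le_of_ne (annih_anti δ η (Nat.le_succ k)) (hne k (by omega)).symm
      have h3 := Submodule.finrank_lt_finrank_of_lt h2
      omega
  have := key _ le_rfl
  omega

/-- Two states with weights that no word shorter than the number of states distinguishes are
equivalent. -/
theorem finVal_eq_of_short {q q' : V} {s s' : S}
    (h : ∀ w : List Γ, w.length < Fintype.card V → s * finVal δ η q w = s' * finVal δ η q' w)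
    (w : List Γ) : s * finVal δ η q w = s' * finVal δ η q' w := by
  classical
  have hp : ∀ w, pairing δ η w (Pi.single q s - Pi.single q' s') =
      s * finVal δ η q w - s' * finVal δ η q' w := by
    intro w
    rw [map_sub, pairing_single, pairing_single]
    ring
  obtain ⟨k, hk, hk'⟩ := exists_annih_eq δ η
  have hm : Pi.single q s - Pi.single q' s' ∈ annih δ η (Fintype.card V) := by
    rw [mem_annih]
    intro w hw
    rw [hp, h w hw, sub_self]
  have hm' := annih_stable δ η hk' (w.length + 1)
    (annih_anti δ η hk hm)
  have := (mem_annih δ η).1 hm' w (by omega)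
  rw [hp] at this
  exact sub_eq_zero.1 this

end FiniteAutomata

/-! ### Configurations unlike any finite automaton state -/

section Incompatible

variable {Γ S Q Q₁ Q₂ V : Type*} [Field S]

/-- The function `F` differs, on the words of length at most `K`, from every function accepted by
the finite automaton `(δ, η)` from one of its states. -/
def Incompatible (δ : V → Γ → V × S) (η : V → S) (K : ℕ) (F : List Γ → S) : Prop :=
  ∀ q s, ∃ w : List Γ, w.length ≤ K ∧ F w ≠ s * finVal δ η q w

theorem Incompatible.congr {δ : V → Γ → V × S} {η : V → S} {K : ℕ} {F G : List Γ → S}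
    (hF : Incompatible δ η K F) (h : ∀ w, w.length ≤ K → F w = G w) : Incompatible δ η K G := by
  intro q s
  obtain ⟨w, hw, hw'⟩ := hF q s
  exact ⟨w, hw, h w hw ▸ hw'⟩

theorem Incompatible.smul {δ : V → Γ → V × S} {η : V → S} {K : ℕ} {F : List Γ → S}
    (hF : Incompatible δ η K F) {t : S} (ht : t ≠ 0) :
    Incompatible δ η K (fun w => t * F w) := by
  intro q s
  obtain ⟨w, hw, hw'⟩ := hF q (t⁻¹ * s)
  refine ⟨w, hw, fun h => hw' ?_⟩
  rw [mul_assoc, ← h, inv_mul_cancel_left₀ ht]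

theorem acceptWeight_append (A : DWROCA Γ S Q) (c : Config S Q) (v w : List Γ) :
    A.acceptWeight (v ++ w) c = A.acceptWeight w (A.run c v) := by
  simp [acceptWeight, run_append]

theorem acceptWeight_eq (A : DWROCA Γ S Q) (c : Config S Q) (w : List Γ) :
    A.acceptWeight w c = c.weight * A.acceptWeight w ⟨c.state, c.counter, 1⟩ := by
  obtain ⟨h1, -, h3⟩ := A.run_same (c := c) (D := ⟨c.state, c.counter, 1⟩) rfl rfl w
  simp only [acceptWeight]
  rw [h3, h1, A.run_weight c]
  ring

/-- While its counter is large, an automaton behaves like the finite automaton of its transitions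
at positive counter values. -/
theorem acceptWeight_of_length_le (A : DWROCA Γ S Q) {δ : V → Γ → V × S} {η : V → S} {ι : Q → V}
    (hδ : ∀ q a, δ (ι q) a = (ι (A.δ₁ q a).1, (A.δ₁ q a).2.2)) (hη : ∀ q, η (ι q) = A.out q)
    (w : List Γ) (c : Config S Q) (hc : w.length ≤ c.counter) :
    A.acceptWeight w c = c.weight * finVal δ η (ι c.state) w := by
  induction w generalizing c with
  | nil => simp [acceptWeight, finVal, hη]
  | cons a w ih =>
    simp only [List.length_cons] at hc
    have hl := A.step_counter_le c a
    have ht : A.trans c a = A.δ₁ c.state a := if_neg (by omega)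
    have := ih (A.step c a) (by omega)
    rw [acceptWeight, run_cons, ← acceptWeight, this]
    simp only [step, ht, finVal, hδ, mul_assoc]

/-- With a counter of at least K, or with weight zero, the configuration is matched by its own state
scaled by its own weight. -/
theorem Incompatible.counter_lt_and_weight_ne_zero (A : DWROCA Γ S Q) {δ : V → Γ → V × S}
    {η : V → S} {ι : Q → V} {K : ℕ}
    (hδ : ∀ q a, δ (ι q) a = (ι (A.δ₁ q a).1, (A.δ₁ q a).2.2)) (hη : ∀ q, η (ι q) = A.out q)
    {c : Config S Q} (h : Incompatible δ η K fun w => A.acceptWeight w c) :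
    c.counter < K ∧ c.weight ≠ 0 := by
  obtain ⟨w, hw, hw'⟩ := h (ι c.state) c.weight
  constructor
  · by_contra! hc
    exact hw' (A.acceptWeight_of_length_le hδ hη w c (by omega))
  · intro h0
    apply hw'
    change A.acceptWeight w c = _
    rw [acceptWeight_eq, h0, zero_mul, zero_mul]

/-- The finite automaton formed by the transitions of `A₁` and `A₂` at positive counter values. -/
def sumδ (A₁ : DWROCA Γ S Q₁) (A₂ : DWROCA Γ S Q₂) : Q₁ ⊕ Q₂ → Γ → (Q₁ ⊕ Q₂) × S
  | .inl q, a => (.inl (A₁.δ₁ q a).1, (A₁.δ₁ q a).2.2)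
  | .inr q, a => (.inr (A₂.δ₁ q a).1, (A₂.δ₁ q a).2.2)

/-- The output function going with `sumδ`. -/
def sumη (A₁ : DWROCA Γ S Q₁) (A₂ : DWROCA Γ S Q₂) : Q₁ ⊕ Q₂ → S := Sum.elim A₁.out A₂.out

end Incompatible

/-! ### Level crossings of sequences with steps of size at most one -/

section Levels

variable {f : ℕ → ℕ} (hf : ∀ i, f (i + 1) ≤ f i + 1 ∧ f i ≤ f (i + 1) + 1)
include hf

theorem exists_last_level {a T j : ℕ} (haT : a ≤ T) (ha : f a ≤ j) (hT : j ≤ f T) :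
    ∃ u, a ≤ u ∧ u ≤ T ∧ f u = j ∧ ∀ k, u < k → k ≤ T → j < f k := by
  induction T, haT using Nat.le_induction with
  | base => exact ⟨a, le_rfl, le_rfl, by omega, fun k _ _ => by omega⟩
  | succ T haT ih =>
    rcases hT.eq_or_lt with h | h
    · exact ⟨T + 1, by omega, le_rfl, h.symm, fun k _ _ => by omega⟩
    · have := hf T
      obtain ⟨u, h1, h2, h3, h4⟩ := ih (by omega)
      refine ⟨u, h1, by omega, h3, fun k hk hk' => ?_⟩
      rcases hk'.eq_or_lt with rfl | hk'
      · exact h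
      · exact h4 k hk (by omega)

theorem exists_first_level {T b j : ℕ} (hTb : T ≤ b) (hT : j ≤ f T) (hb : f b ≤ j) :
    ∃ r, T ≤ r ∧ r ≤ b ∧ f r = j ∧ ∀ k, T ≤ k → k < r → j < f k := by
  have hex : ∃ r, T ≤ r ∧ f r ≤ j := ⟨b, hTb, hb⟩
  classical
  have h1 := Nat.find_spec hex
  have h2 : ∀ k, T ≤ k → k < Nat.find hex → j < f k := fun k hk hk' => by
    have := Nat.find_min hex hk'
    by_contra! h
    exact this ⟨hk, h⟩
  refine ⟨Nat.find hex, h1.1, Nat.find_min' hex ⟨hTb, hb⟩, ?_, h2⟩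
  rcases h1.1.eq_or_lt with h | h
  · rw [← h] at h1 ⊢
    omega
  · have h3 := h2 (Nat.find hex - 1) (by omega) (by omega)
    have h4 := hf (Nat.find hex - 1)
    rw [Nat.sub_add_cancel (by omega)] at h4
    omega

end Levels

/-! ### Short words reaching a set of configurations -/

section Hit

variable {Γ S Q : Type*} [Field S] (A : DWROCA Γ S Q)

theorem weight_ne_zero_of_le {c₀ : Config S Q} {w : List Γ} {i e : ℕ} (hie : i ≤ e)
    (h : (A.run c₀ (w.take e)).weight ≠ 0) :
    (A.run c₀ (w.take i)).weight ≠ 0 ∧ A.factor (A.run c₀ (w.take i)) (seg w i e) ≠ 0 := by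
  rw [← run_take_seg A c₀ w hie, run_weight] at h
  exact mul_ne_zero_iff.1 h

/-- A run that climbs from the level `j` to the level `j'`, stays above it, and descends to `j`
again can be shortened by leaving out the parts between the two levels. -/
theorem run_cut (c₀ : Config S Q) (w : List Γ) {u u' r' r e : ℕ} (hu : u' ≤ r') (hr : r ≤ e)
    (hr' : r' ≤ r) (he : e ≤ w.length)
    (hs : (A.run c₀ (w.take u)).state = (A.run c₀ (w.take u')).state)
    (hs' : (A.run c₀ (w.take r')).state = (A.run c₀ (w.take r)).state)
    (hn : (A.run c₀ (w.take u)).counter = (A.run c₀ (w.take r)).counter)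
    (hn' : (A.run c₀ (w.take u')).counter = (A.run c₀ (w.take r')).counter)
    (h0 : 0 < (A.run c₀ (w.take u)).counter)
    (hge : ∀ k, u' ≤ k → k < r' → (A.run c₀ (w.take u')).counter ≤ (A.run c₀ (w.take k)).counter)
    (huu : (A.run c₀ (w.take u)).counter ≤ (A.run c₀ (w.take u')).counter) :
    (A.run c₀ (w.take u ++ seg w u' r' ++ seg w r e)).state = (A.run c₀ (w.take e)).state ∧
    (A.run c₀ (w.take u ++ seg w u' r' ++ seg w r e)).counter = (A.run c₀ (w.take e)).counter ∧
    (A.run c₀ (w.take u ++ seg w u' r' ++ seg w r e)).weight =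
      (A.run c₀ (w.take u)).weight * A.factor (A.run c₀ (w.take u')) (seg w u' r') *
        A.factor (A.run c₀ (w.take r)) (seg w r e) := by
  obtain ⟨h1, h2, h3⟩ := A.run_resume c₀ w (i := u') (k := r') (D := A.run c₀ (w.take u))
    (δ := (A.run c₀ (w.take u)).counter - (A.run c₀ (w.take u')).counter) hs (by ring) hu
    (by omega) (fun l hl hl' => by have := hge l hl hl'; omega)
  obtain ⟨g1, g2, g3⟩ := A.run_resume c₀ w (i := r) (k := e)
    (D := A.run (A.run c₀ (w.take u)) (seg w u' r'))
    (δ := 0) (h1.trans hs') (by omega) hr he (fun l hl hl' => by simp)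
  rw [run_append, run_append]
  exact ⟨g1, by omega, by rw [g3, h3]⟩

/-- Reading `v` from `c` leads to a configuration of nonzero weight with state and counter value
in `J`. -/
def Hit (J : Q → ℕ → Prop) (c : Config S Q) (v : List Γ) : Prop :=
  (A.run c v).weight ≠ 0 ∧ J (A.run c v).state (A.run c v).counter

variable {A} {J : Q → ℕ → Prop} {K : ℕ}

theorem hit_append {c : Config S Q} {v v' : List Γ} :
    A.Hit J c (v ++ v') ↔ A.Hit J (A.run c v) v' := by
  rw [Hit, Hit, run_append]

theorem hit_seg {c₀ : Config S Q} {w : List Γ} {i e : ℕ} (hie : i ≤ e) :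
    A.Hit J (A.run c₀ (w.take i)) (seg w i e) ↔ A.Hit J c₀ (w.take e) := by
  rw [← hit_append, take_append_seg w hie]

theorem Hit.congr {c D : Config S Q} {v : List Γ} (h : A.Hit J c v) (hs : D.state = c.state)
    (hn : D.counter = c.counter) (hw : D.weight ≠ 0) : A.Hit J D v := by
  obtain ⟨h1, h2, h3⟩ := A.run_same hs hn v
  have h4 := h.1
  rw [run_weight] at h4
  exact ⟨by rw [h3]; exact mul_ne_zero hw (mul_ne_zero_iff.1 h4).2, by rw [h1, h2]; exact h.2⟩

theorem Hit.counter_lt (hJ : ∀ q n, J q n → n < K) {c : Config S Q} {v : List Γ}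
    (h : A.Hit J c v) : c.counter < v.length + K := by
  have h1 := A.run_counter_le c v
  have h2 := hJ _ _ h.2
  omega

/-- Over a field the factors of a nonzero weight are nonzero, so dropping some of them cannot
destroy a hit. -/
theorem Hit.cut {c₀ : Config S Q} {w : List Γ} {u u' r' r e : ℕ} (hu : u' ≤ r') (hr : r ≤ e)
    (hr' : r' ≤ r) (he : e ≤ w.length) (h : A.Hit J c₀ (w.take e))
    (hs : (A.run c₀ (w.take u)).state = (A.run c₀ (w.take u')).state)
    (hs' : (A.run c₀ (w.take r')).state = (A.run c₀ (w.take r)).state)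
    (hn : (A.run c₀ (w.take u)).counter = (A.run c₀ (w.take r)).counter)
    (hn' : (A.run c₀ (w.take u')).counter = (A.run c₀ (w.take r')).counter)
    (h0 : 0 < (A.run c₀ (w.take u)).counter)
    (hge : ∀ k, u' ≤ k → k < r' → (A.run c₀ (w.take u')).counter ≤ (A.run c₀ (w.take k)).counter)
    (huu : (A.run c₀ (w.take u)).counter ≤ (A.run c₀ (w.take u')).counter) (huu' : u ≤ u') :
    A.Hit J c₀ (w.take u ++ seg w u' r' ++ seg w r e) := by
  obtain ⟨h1, h2, h3⟩ := A.run_cut c₀ w hu hr hr' he hs hs' hn hn' h0 hge huu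
  refine ⟨?_, by rw [h1, h2]; exact h.2⟩
  rw [h3]
  have hr0 := A.weight_ne_zero_of_le (hr'.trans hr) h.1
  exact mul_ne_zero (mul_ne_zero (A.weight_ne_zero_of_le (by omega) h.1).1
    (A.weight_ne_zero_of_le hu hr0.1).2) (A.weight_ne_zero_of_le hr h.1).2

variable [Fintype Q]

/-- Above the larger of the start and end levels, the card^2 + 1 levels below a higher peak would
contain two with the same states on ascent and descent; cutting there shortens the hit. -/
theorem Hit.counter_le_of_minimal (hJ : ∀ q n, J q n → n < K) {c : Config S Q} {v : List Γ}
    (h : A.Hit J c v) (hmin : ∀ v', A.Hit J c v' → v.length ≤ v'.length) {i : ℕ}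
    (hi : i ≤ v.length) :
    (A.run c (v.take i)).counter ≤ c.counter + K + Fintype.card Q ^ 2 := by
  by_contra! hlt
  set f : ℕ → ℕ := fun i => (A.run c (v.take i)).counter with hfdef
  have hf : ∀ i, f (i + 1) ≤ f i + 1 ∧ f i ≤ f (i + 1) + 1 := A.counter_take_succ c v
  have hf0 : f 0 = c.counter := by simp [f]
  have hv : A.Hit J c (v.take v.length) := by simpa using h
  have hfe : f v.length < K := hJ _ _ hv.2
  have hU : ∀ t : Fin (Fintype.card Q ^ 2 + 1), ∃ u, u ≤ i ∧ f u = c.counter + K + t ∧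
      ∀ k, u < k → k ≤ i → c.counter + K + t < f k := by
    intro t
    obtain ⟨u, -, h2, h3, h4⟩ := exists_last_level hf (Nat.zero_le i)
      (j := c.counter + K + t) (by omega) (by have := t.2; simp only [hfdef]; omega)
    exact ⟨u, h2, h3, h4⟩
  have hR : ∀ t : Fin (Fintype.card Q ^ 2 + 1), ∃ r, i ≤ r ∧ r ≤ v.length ∧
      f r = c.counter + K + t ∧ ∀ k, i ≤ k → k < r → c.counter + K + t < f k := by
    intro t
    exact exists_first_level hf hi (by have := t.2; simp only [hfdef]; omega) (by omega)
  choose u hu1 hu2 hu3 using hU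
  choose r hr1 hr2 hr3 hr4 using hR
  obtain ⟨t, t', hne, heq⟩ := Fintype.exists_ne_map_eq_of_card_lt
    (fun t => ((A.run c (v.take (u t))).state, (A.run c (v.take (r t))).state))
    (by simp [sq])
  wlog htt : t < t' generalizing t t'
  · exact this t' t hne.symm heq.symm (lt_of_le_of_ne (not_lt.1 htt) hne.symm)
  have htt' : (t : ℕ) < t' := htt
  simp only [Prod.mk.injEq] at heq
  have huu : u t < u t' := by
    by_contra! hle
    rcases hle.eq_or_lt with h' | h'
    · have e1 := hu2 t; have e2 := hu2 t'; rw [h'] at e2; omega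
    · have e1 := hu2 t; have := hu3 t' (u t) h' (hu1 t); omega
  have hrr : r t' ≤ r t := by
    by_contra! hle
    have e1 := hr3 t; have := hr4 t' (r t) (hr1 t) hle; omega
  have hcut := hv.cut (hu1 t' |>.trans (hr1 t')) (hr2 t) hrr le_rfl heq.1 heq.2.symm
    ((hu2 t).trans (hr3 t).symm) ((hu2 t').trans (hr3 t').symm)
    (by have := hu2 t; simp only [hfdef] at this; omega)
    (fun k hk hk' => by
      change f _ ≤ f _
      rcases le_total k i with hki | hki
      · rcases hk.eq_or_lt with rfl | hk
        · exact le_rfl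
        · have := hu3 t' k hk hki; have := hu2 t'; omega
      · have := hr4 t' k hki hk'; have := hu2 t'; omega)
    (by change f _ ≤ f _; rw [hu2, hu2]; omega) huu.le
  have hlen := hmin _ hcut
  have := hu1 t'; have := hr1 t'; have := hr2 t; have := hr2 t'
  simp only [List.length_append, List.length_take] at hlen
  rw [seg_length _ (hr2 t'), seg_length _ le_rfl] at hlen
  omega

/-- If `J` can be reached from `c`, then by a word whose length is at most linear in the counter
value. -/
theorem Hit.exists_short (hJ : ∀ q n, J q n → n < K) (hK : Fintype.card Q < K) {c : Config S Q}
    {v : List Γ} (h : A.Hit J c v) :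
    ∃ v', A.Hit J c v' ∧ v'.length ≤ v.length ∧ v'.length ≤ K * c.counter + K ^ 3 := by
  classical
  have hex : ∃ n, ∃ v, A.Hit J c v ∧ v.length = n := ⟨_, v, h, rfl⟩
  obtain ⟨v', hv', hl⟩ := Nat.find_spec hex
  have hmin : ∀ v'', A.Hit J c v'' → v'.length ≤ v''.length := fun v'' h'' => by
    rw [hl]; exact Nat.find_min' hex ⟨v'', h'', rfl⟩
  refine ⟨v', hv', hmin v h, ?_⟩
  have hv : A.Hit J c (v'.take v'.length) := by simpa using hv'
  let g : Fin (v'.length + 1) → Q × Fin (c.counter + K + Fintype.card Q ^ 2 + 1) := fun i =>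
    ((A.run c (v'.take i)).state, ⟨(A.run c (v'.take i)).counter,
      Nat.lt_succ_of_le (hv'.counter_le_of_minimal hJ hmin (Nat.lt_succ_iff.1 i.2))⟩)
  -- A repeated state and counter value would allow the loop to be removed.
  have hg : Function.Injective g := by
    intro i i' heq
    by_contra hne
    wlog hlt : i < i' generalizing i i'
    · exact this heq.symm (Ne.symm hne) (lt_of_le_of_ne (not_lt.1 hlt) (Ne.symm hne))
    have hlt' : (i : ℕ) < i' := hlt
    have hi' := i'.2
    simp only [g, Prod.mk.injEq, Fin.mk.injEq] at heq
    have h1 : A.Hit J (A.run c (v'.take i')) (seg v' i' v'.length) :=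
      (hit_seg (by omega)).2 hv
    have h2 := h1.congr heq.1 heq.2 (A.weight_ne_zero_of_le (by omega) hv.1).1
    rw [← hit_append] at h2
    have h3 := hmin _ h2
    rw [List.length_append, seg_length _ le_rfl, List.length_take] at h3
    omega
  have hcard := Fintype.card_le_of_injective g hg
  simp only [Fintype.card_fin, Fintype.card_prod] at hcard
  obtain ⟨t, rfl⟩ := Nat.exists_eq_add_of_lt hK
  have key : ∀ m n t : ℕ,
      m * (n + (m + t + 1) + m ^ 2 + 1) ≤ (m + t + 1) * n + (m + t + 1) ^ 3 := by
    intro m n t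
    zify
    nlinarith [mul_nonneg (Nat.cast_nonneg (α := ℤ) t) (Nat.cast_nonneg (α := ℤ) n),
      mul_nonneg (Nat.cast_nonneg (α := ℤ) t) (Nat.cast_nonneg (α := ℤ) m),
      mul_nonneg (Nat.cast_nonneg (α := ℤ) t) (sq_nonneg (m : ℤ)),
      mul_nonneg (Nat.cast_nonneg (α := ℤ) m) (sq_nonneg (t : ℤ)),
      pow_nonneg (Nat.cast_nonneg (α := ℤ) t) 3, sq_nonneg (t : ℤ), sq_nonneg (m : ℤ)]
  have := key (Fintype.card Q) c.counter t
  omega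

end Hit

/-! ### Synchronised automata and the effect of cuts -/

section Sync

variable {Γ S Q₁ Q₂ : Type*} [Field S] [Fintype Q₁] [Fintype Q₂]

/-- The words shorter than `E` that lead from `c₁` to `J₁` are those that lead from `c₂` to
`J₂`. -/
structure InSync (A₁ : DWROCA Γ S Q₁) (A₂ : DWROCA Γ S Q₂) (J₁ : Q₁ → ℕ → Prop)
    (J₂ : Q₂ → ℕ → Prop) (K E : ℕ) (c₁ : Config S Q₁) (c₂ : Config S Q₂) : Prop where
  lt₁ : ∀ q n, J₁ q n → n < K
  lt₂ : ∀ q n, J₂ q n → n < K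
  card₁ : Fintype.card Q₁ < K
  card₂ : Fintype.card Q₂ < K
  sync : ∀ p : List Γ, p.length < E → (A₁.Hit J₁ c₁ p ↔ A₂.Hit J₂ c₂ p)

variable {A₁ : DWROCA Γ S Q₁} {A₂ : DWROCA Γ S Q₂} {J₁ : Q₁ → ℕ → Prop} {J₂ : Q₂ → ℕ → Prop}
  {K E : ℕ} {c₁ : Config S Q₁} {c₂ : Config S Q₂}

/-- Shortening for the first automaton, transferring, and shortening again for the second yields one
word subject to the length bounds of both. -/
theorem InSync.exists_common (h : InSync A₁ A₂ J₁ J₂ K E c₁ c₂) {p v : List Γ}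
    (hv : A₁.Hit J₁ (A₁.run c₁ p) v) (hl : p.length + v.length < E) :
    ∃ v', A₁.Hit J₁ (A₁.run c₁ p) v' ∧ v'.length ≤ v.length ∧
      v'.length ≤ K * (A₁.run c₁ p).counter + K ^ 3 ∧
      v'.length ≤ K * (A₂.run c₂ p).counter + K ^ 3 ∧
      (A₁.run c₁ p).counter < v'.length + K ∧ (A₂.run c₂ p).counter < v'.length + K := by
  obtain ⟨v₁, h1, h1', h1''⟩ := hv.exists_short h.lt₁ h.card₁
  rw [← hit_append, h.sync _ (by rw [List.length_append]; omega), hit_append] at h1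
  obtain ⟨v₂, h2, h2', h2''⟩ := h1.exists_short h.lt₂ h.card₂
  have h3 := h2
  rw [← hit_append, ← h.sync _ (by rw [List.length_append]; omega), hit_append] at h3
  exact ⟨v₂, h3, by omega, by omega, h2'', h3.counter_lt h.lt₁, h2.counter_lt h.lt₂⟩

/-- Times `u < u' ≤ r' ≤ r` such that the parts of `w` between `u` and `u'` and between `r'` and
`r` can be left out of the run of `A₁`. -/
structure CutPoints (A₁ : DWROCA Γ S Q₁) (A₂ : DWROCA Γ S Q₂) (J₁ : Q₁ → ℕ → Prop)
    (K E : ℕ) (c₁ : Config S Q₁) (c₂ : Config S Q₂) (w : List Γ) (u u' r' r : ℕ) : Prop where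
  u_lt : u < u'
  u_le : u' ≤ r'
  r_le : r' ≤ r
  r_leE : r ≤ E
  E_le : E ≤ w.length
  state₁_u : (A₁.run c₁ (w.take u)).state = (A₁.run c₁ (w.take u')).state
  state₂_u : (A₂.run c₂ (w.take u)).state = (A₂.run c₂ (w.take u')).state
  state₁_r : (A₁.run c₁ (w.take r')).state = (A₁.run c₁ (w.take r)).state
  state₂_r : (A₂.run c₂ (w.take r')).state = (A₂.run c₂ (w.take r)).state
  counter_u : (A₁.run c₁ (w.take u)).counter = (A₁.run c₁ (w.take r)).counter
  counter_u' : (A₁.run c₁ (w.take u')).counter = (A₁.run c₁ (w.take r')).counter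
  low : K ^ 3 + K ≤ (A₁.run c₁ (w.take u)).counter
  counter_le : (A₁.run c₁ (w.take u)).counter ≤ (A₁.run c₁ (w.take u')).counter
  ge : ∀ k, u' ≤ k → k ≤ r' → (A₁.run c₁ (w.take u')).counter ≤ (A₁.run c₁ (w.take k)).counter
  hit : A₁.Hit J₁ c₁ (w.take E)

variable {w : List Γ} {u u' r' r : ℕ}

/-- Between the cuts the first counter stays at or above K^3 + K, so the distance to `J₁` exceeds
K^3 and the synchronised second counter cannot be zero. By induction all its zero tests come out as
in the original run. -/
theorem InSync.cut_mid (h : InSync A₁ A₂ J₁ J₂ K E c₁ c₂)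
    (hc : CutPoints A₁ A₂ J₁ K E c₁ c₂ w u u' r' r) {m : ℕ} (hm : m ≤ r')
    (hY : ∀ k, u' ≤ k → k < m → 0 < (A₂.run c₂ (w.take k)).counter) (k : ℕ) (huk : u' ≤ k)
    (hkm : k ≤ m) :
    (A₂.run c₂ (w.take u ++ seg w u' k)).state = (A₂.run c₂ (w.take k)).state ∧
    ((A₂.run c₂ (w.take u ++ seg w u' k)).counter : ℤ) = (A₂.run c₂ (w.take k)).counter +
      ((A₂.run c₂ (w.take u)).counter - (A₂.run c₂ (w.take u')).counter) ∧
    (A₂.run c₂ (w.take u ++ seg w u' k)).weight = (A₂.run c₂ (w.take u)).weight *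
      A₂.factor (A₂.run c₂ (w.take u')) (seg w u' k) ∧
    ∃ v, (A₁.run c₁ (w.take u)).counter <
        v + K ∧ v ≤ K * (A₂.run c₂ (w.take u ++ seg w u' k)).counter + K ^ 3 ∧
      0 < (A₂.run c₂ (w.take u ++ seg w u' k)).counter := by
  have hlow := hc.low
  have hle := hc.counter_le
  have hU := hc.u_lt
  have hr1 := hc.r_le
  have hr2 := hc.r_leE
  have hr3 := hc.E_le
  have hK := h.card₁
  have hhit := hc.hit.cut hc.u_le hc.r_leE hc.r_le hc.E_le hc.state₁_u hc.state₁_r hc.counter_u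
    hc.counter_u' (by omega) (fun k hk hk' => hc.ge k hk hk'.le) hc.counter_le hc.u_lt.le
  induction k using Nat.strong_induction_on with
  | _ k ih =>
    obtain ⟨g1, g2, -⟩ := A₁.run_resume c₁ w (i := u') (k := k) (D := A₁.run c₁ (w.take u))
      (δ := (A₁.run c₁ (w.take u)).counter - (A₁.run c₁ (w.take u')).counter) hc.state₁_u
      (by ring) huk (by omega)
      (fun l hl hl' => by have := hc.ge l hl (by omega); omega)
    obtain ⟨h1, h2, h3⟩ := A₂.run_resume c₂ w (i := u') (k := k) (D := A₂.run c₂ (w.take u))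
      (δ := (A₂.run c₂ (w.take u)).counter - (A₂.run c₂ (w.take u')).counter) hc.state₂_u
      (by ring) huk (by omega)
      (fun l hl hl' => by
        have := hY l hl (by omega)
        obtain ⟨-, e, -, -, -, -, e'⟩ := ih l hl' hl (by omega)
        omega)
    rw [← run_append] at h1 h2 h3 g2
    refine ⟨h1, h2, h3, ?_⟩
    rw [← seg_append_seg w huk (hkm.trans hm), ← List.append_assoc, List.append_assoc,
      hit_append] at hhit
    -- The cut deletes at least one letter before E, so the total length is in the range of `sync`.
    obtain ⟨v', -, -, -, f3, f4, f5⟩ := h.exists_common hhit (by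
      simp only [List.length_append, List.length_take]
      rw [seg_length _ (by omega), seg_length _ (by omega), seg_length _ (by omega)]
      omega)
    have hge := hc.ge k huk (by omega)
    refine ⟨v'.length, by omega, f3, ?_⟩
    rcases Nat.eq_zero_or_pos (A₂.run c₂ (w.take u ++ seg w u' k)).counter with h0 | h0
    · rw [h0] at f3
      omega
    · exact h0

/-- After the second cut the first automaton is back in its original state and counter value, so
`hfar` keeps the distance above K^3 and again excludes a zero of the second counter before b. -/
theorem InSync.cut_end (h : InSync A₁ A₂ J₁ J₂ K E c₁ c₂)
    (hc : CutPoints A₁ A₂ J₁ K E c₁ c₂ w u u' r' r) {b : ℕ} (hrb : r ≤ b) (hb : b ≤ E)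
    (hY : ∀ k, u' ≤ k → k < b → 0 < (A₂.run c₂ (w.take k)).counter)
    (hfar : ∀ k, r ≤ k → k < b → ∀ v : List Γ, v.length ≤ K ^ 3 →
      ¬ A₁.Hit J₁ (A₁.run c₁ (w.take k)) v) (k : ℕ) (hrk : r ≤ k) (hkb : k ≤ b)
    {v : List Γ} (hv : A₁.Hit J₁ (A₁.run c₁ (w.take k)) v) (hvl : k + v.length ≤ E) :
    ∃ (v' : List Γ) (y : ℕ), A₁.Hit J₁ (A₁.run c₁ (w.take k)) v' ∧ v'.length ≤ v.length ∧
      v'.length ≤ K * y + K ^ 3 ∧ y < v'.length + K ∧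
      (y : ℤ) = (A₂.run c₂ (w.take k)).counter +
        ((A₂.run c₂ (w.take u)).counter - (A₂.run c₂ (w.take u')).counter +
          ((A₂.run c₂ (w.take r')).counter - (A₂.run c₂ (w.take r)).counter)) := by
  have hlow := hc.low
  have hle := hc.counter_le
  have hU := hc.u_lt
  have hU' := hc.u_le
  have hr1 := hc.r_le
  have hr3 := hc.E_le
  have hK := h.card₁
  obtain ⟨m1, m2, m3, -⟩ := h.cut_mid hc le_rfl (fun k hk hk' => hY k hk (by omega)) r' hc.u_le
    le_rfl
  induction k using Nat.strong_induction_on generalizing v with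
  | _ k ih =>
    obtain ⟨g1, g2, g3⟩ := A₁.run_cut c₁ w hc.u_le hrk hc.r_le (by omega) hc.state₁_u hc.state₁_r
      hc.counter_u hc.counter_u' (by omega) (fun k hk hk' => hc.ge k hk hk'.le) hc.counter_le
    obtain ⟨h1, h2, h3⟩ := A₂.run_resume c₂ w (i := r) (k := k)
      (D := A₂.run c₂ (w.take u ++ seg w u' r'))
      (δ := ((A₂.run c₂ (w.take u)).counter - (A₂.run c₂ (w.take u')).counter +
          ((A₂.run c₂ (w.take r')).counter - (A₂.run c₂ (w.take r)).counter)))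
      (m1.trans hc.state₂_r) (by omega) hrk (by omega)
      (fun l hl hl' => by
        have := hY l (by omega) (by omega)
        obtain ⟨v', y, q1, q2, q3, q4, q5⟩ := ih l hl' hl (by omega)
          (v := seg w l E) ((hit_seg (by omega)).2 hc.hit) (by rw [seg_length _ hc.E_le]; omega)
        have hy : y ≠ 0 := by
          rintro rfl
          exact hfar l hl (by omega) v' (by omega) q1
        omega)
    rw [← run_append] at h1 h2
    have hw := A₁.weight_ne_zero_of_le (c₀ := c₁) (w := w) (i := k) (e := E) (by omega) hc.hit.1
    have hwr := A₁.weight_ne_zero_of_le (c₀ := c₁) (w := w) (i := r) (e := k) hrk hw.1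
    have hwr' := A₁.weight_ne_zero_of_le (c₀ := c₁) (w := w) hc.r_le hwr.1
    have hwu' := A₁.weight_ne_zero_of_le (c₀ := c₁) (w := w) hc.u_le hwr'.1
    have hwu := A₁.weight_ne_zero_of_le (c₀ := c₁) (w := w) hc.u_lt.le hwu'.1
    have hne : (A₁.run c₁ (w.take u ++ seg w u' r' ++ seg w r k)).weight ≠ 0 := by
      rw [g3]
      exact mul_ne_zero (mul_ne_zero hwu.1 hwu'.2) hwr.2
    obtain ⟨v', f1, f2, -, f3, -, f5⟩ := h.exists_common (hv.congr g1 g2 hne) (by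
      simp only [List.length_append, List.length_take]
      rw [seg_length _ (by omega), seg_length _ (by omega)]
      omega)
    exact ⟨v', _, f1.congr g1.symm g2.symm hw.1, f2, f3, f5, h2⟩

/-- A cut that does not change the counter value of the second automaton. -/
theorem InSync.acceptWeight_cut (h : InSync A₁ A₂ J₁ J₂ K E c₁ c₂)
    (hc : CutPoints A₁ A₂ J₁ K E c₁ c₂ w u u' r' r)
    (hY : ∀ k, u' ≤ k → k < r' → 0 < (A₂.run c₂ (w.take k)).counter)
    (heq : ((A₂.run c₂ (w.take u)).counter : ℤ) - (A₂.run c₂ (w.take r)).counter =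
      (A₂.run c₂ (w.take u')).counter - (A₂.run c₂ (w.take r')).counter) :
    (A₁.acceptWeight (w.take u ++ seg w u' r' ++ seg w r w.length) c₁ =
      (A₁.run c₁ (w.take u)).weight * A₁.factor (A₁.run c₁ (w.take u')) (seg w u' r') *
        A₁.factor (A₁.run c₁ (w.take r)) (seg w r w.length) * A₁.out (A₁.run c₁ w).state) ∧
    A₂.acceptWeight (w.take u ++ seg w u' r' ++ seg w r w.length) c₂ =
      (A₂.run c₂ (w.take u)).weight * A₂.factor (A₂.run c₂ (w.take u')) (seg w u' r') *
        A₂.factor (A₂.run c₂ (w.take r)) (seg w r w.length) * A₂.out (A₂.run c₂ w).state := by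
  have hlow := hc.low
  have hK := h.card₁
  have hr := hc.r_leE
  have hE := hc.E_le
  obtain ⟨g1, g2, g3⟩ := A₁.run_cut c₁ w hc.u_le (hc.r_leE.trans hc.E_le) hc.r_le le_rfl
    hc.state₁_u hc.state₁_r hc.counter_u hc.counter_u' (by omega)
    (fun k hk hk' => hc.ge k hk hk'.le) hc.counter_le
  obtain ⟨m1, m2, m3, -⟩ := h.cut_mid hc le_rfl hY r' hc.u_le le_rfl
  obtain ⟨h1, h2, h3⟩ := A₂.run_resume c₂ w (i := r) (k := w.length)
      (D := A₂.run c₂ (w.take u ++ seg w u' r')) (δ := 0)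
      (m1.trans hc.state₂_r) (by omega) (by omega) le_rfl (fun l _ _ => by simp)
  rw [← run_append] at h1 h3
  rw [List.take_length] at g1 h1
  exact ⟨by rw [acceptWeight, g3, g1], by rw [acceptWeight, h3, m3, h1]⟩

end Sync

/-! ### Pigeonhole and telescoping on levels -/

section Combinatorics

theorem exists_mul_le_sub {C : Finset ℕ} {F : ℕ → ℤ} {m : ℤ}
    (h : ∀ j ∈ C, ∀ j' ∈ C, j < j' → m ≤ F j - F j') {t : ℕ} (ht : t < C.card) (h0 : 0 < t) :
    ∃ j ∈ C, ∃ j' ∈ C, j < j' ∧ (∀ i ∈ C, j ≤ i) ∧ t * m ≤ F j - F j' := by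
  let e := C.orderEmbOfFin rfl
  have key : ∀ t (ht : t < C.card), t * m ≤ F (e ⟨0, by omega⟩) - F (e ⟨t, ht⟩) := by
    intro t
    induction t with
    | zero => intro _; simp
    | succ t ih =>
      intro ht
      have h1 := ih (by omega)
      have h2 := h (e ⟨t, by omega⟩) (C.orderEmbOfFin_mem rfl _) (e ⟨t + 1, ht⟩)
        (C.orderEmbOfFin_mem rfl _) (e.lt_iff_lt.2 (by simp))
      push_cast
      linarith
  refine ⟨_, C.orderEmbOfFin_mem rfl _, _, C.orderEmbOfFin_mem rfl _,
    e.lt_iff_lt.2 (by simpa using h0), fun i hi => ?_, key t ht⟩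
  rw [Finset.orderEmbOfFin_zero rfl (by omega)]
  exact C.min'_le i hi

theorem exists_three_eq {C : Finset ℕ} {F : ℕ → ℤ} {y : ℤ} {k : ℕ}
    (h : ∀ j ∈ C, ∀ j' ∈ C, j < j' → 0 ≤ y + (F j - F j') ∧ y + (F j - F j') < k)
    (hC : 2 * k + 1 < C.card) :
    ∃ j ∈ C, ∃ j' ∈ C, ∃ j'' ∈ C, j < j' ∧ j' < j'' ∧ F j = F j' ∧ F j' = F j'' := by
  have hne : C.Nonempty := Finset.card_pos.1 (by omega)
  have hmin := C.min'_mem hne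
  -- Comparing everything with the least level leaves at most k values of F for more than 2k levels.
  have hmaps : ∀ j ∈ C.erase (C.min' hne), y + (F (C.min' hne) - F j) ∈ Finset.Ico (0 : ℤ) k := by
    intro j hj
    rw [Finset.mem_Ico]
    exact h _ hmin j (Finset.mem_of_mem_erase hj) (C.min'_lt_of_mem_erase_min' hne hj)
  obtain ⟨z, -, hz⟩ := Finset.exists_lt_card_fiber_of_mul_lt_card_of_maps_to hmaps (n := 2) (by
    rw [Finset.card_erase_of_mem hmin, Int.card_Ico]
    simp only [sub_zero, Int.toNat_natCast]
    omega)
  set D := {j ∈ C.erase (C.min' hne) | y + (F (C.min' hne) - F j) = z}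
  let e := D.orderEmbOfFin rfl
  have hmem : ∀ i, e i ∈ C ∧ y + (F (C.min' hne) - F (e i)) = z := by
    intro i
    have := Finset.mem_filter.1 (D.orderEmbOfFin_mem rfl i)
    exact ⟨Finset.mem_of_mem_erase this.1, this.2⟩
  have h0 := hmem ⟨0, by omega⟩
  have h1 := hmem ⟨1, by omega⟩
  have h2 := hmem ⟨2, hz⟩
  exact ⟨_, h0.1, _, h1.1, _, h2.1, e.lt_iff_lt.2 (by simp), e.lt_iff_lt.2 (by simp),
    by linarith [h0.2, h1.2], by linarith [h1.2, h2.2]⟩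

theorem exists_large_class {β : Type*} [Fintype β] (φ : ℕ → β) {K : ℕ}
    (hβ : Fintype.card β ≤ K ^ 4) (lo : ℕ) :
    ∃ C ⊆ Finset.Icc lo (lo + 3 * K ^ 8), 3 * K ^ 4 < C.card ∧
      ∀ j ∈ C, ∀ j' ∈ C, φ j = φ j' := by
  classical
  obtain ⟨z, -, hz⟩ := Finset.exists_lt_card_fiber_of_mul_lt_card_of_maps_to
    (s := Finset.Icc lo (lo + 3 * K ^ 8)) (t := Finset.univ) (f := φ) (fun _ _ => Finset.mem_univ _)
    (n := 3 * K ^ 4) (by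
      rw [Nat.card_Icc, Finset.card_univ]
      have := Nat.mul_le_mul_right (3 * K ^ 4) hβ
      have e : K ^ 4 * (3 * K ^ 4) = 3 * K ^ 8 := by ring
      omega)
  exact ⟨_, Finset.filter_subset _ _, hz, fun j hj j' hj' =>
    (Finset.mem_filter.1 hj).2.trans (Finset.mem_filter.1 hj').2.symm⟩

end Combinatorics

/-! ### Bounding the counter by cutting the peak -/

section Main

variable {Γ S Q Q₁ Q₂ : Type*} [Field S]

theorem factor_seg (A : DWROCA Γ S Q) (c₀ : Config S Q) (w : List Γ) {i j k : ℕ} (hij : i ≤ j)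
    (hjk : j ≤ k) :
    A.factor (A.run c₀ (w.take i)) (seg w i k) = A.factor (A.run c₀ (w.take i)) (seg w i j) *
      A.factor (A.run c₀ (w.take j)) (seg w j k) := by
  rw [← seg_append_seg w hij hjk, factor_append, run_take_seg A c₀ w hij]

theorem acceptWeight_eq_factor (A : DWROCA Γ S Q) (c₀ : Config S Q) (w : List Γ) {i : ℕ}
    (hi : i ≤ w.length) :
    A.acceptWeight w c₀ = (A.run c₀ (w.take i)).weight *
      A.factor (A.run c₀ (w.take i)) (seg w i w.length) * A.out (A.run c₀ w).state := by
  have : A.run c₀ w = A.run (A.run c₀ (w.take i)) (seg w i w.length) := by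
    rw [run_take_seg A c₀ w hi, List.take_length]
  rw [acceptWeight, ← run_weight, ← this]

theorem weight_take (A : DWROCA Γ S Q) (c₀ : Config S Q) (w : List Γ) {i j : ℕ}
    (hij : i ≤ j) : (A.run c₀ (w.take j)).weight = (A.run c₀ (w.take i)).weight *
      A.factor (A.run c₀ (w.take i)) (seg w i j) := by
  rw [← run_weight, run_take_seg A c₀ w hij]

/-- P is the weight left after both cuts; α and β are the factors of the outer and the inner cut
pieces. -/
theorem eq_of_cuts_eq {P α β P' α' β' : S} (h1 : P * β = P' * β') (h2 : P * α = P' * α')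
    (h3 : P = P') : P * α * β = P' * α' * β' := by
  subst h3
  by_cases hP : P = 0
  · simp [hP]
  · rw [mul_left_cancel₀ hP h1, mul_left_cancel₀ hP h2]

variable [Fintype Q₁] [Fintype Q₂]
  {A₁ : DWROCA Γ S Q₁} {A₂ : DWROCA Γ S Q₂} {J₁ : Q₁ → ℕ → Prop} {J₂ : Q₂ → ℕ → Prop}
  {K E : ℕ} {c₁ : Config S Q₁} {c₂ : Config S Q₂} {w : List Γ}

theorem InSync.acceptWeight_eq_of_cuts (h : InSync A₁ A₂ J₁ J₂ K E c₁ c₂)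
    (hag : ∀ v : List Γ, v.length < w.length → A₁.acceptWeight v c₁ = A₂.acceptWeight v c₂)
    {u u' u'' r'' r' r : ℕ}
    (hc1 : CutPoints A₁ A₂ J₁ K E c₁ c₂ w u u' r' r)
    (hc2 : CutPoints A₁ A₂ J₁ K E c₁ c₂ w u' u'' r'' r')
    (hc3 : CutPoints A₁ A₂ J₁ K E c₁ c₂ w u u'' r'' r)
    (hY : ∀ k, u' ≤ k → k < r' → 0 < (A₂.run c₂ (w.take k)).counter)
    (heq : ((A₂.run c₂ (w.take u)).counter : ℤ) - (A₂.run c₂ (w.take r)).counter =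
      (A₂.run c₂ (w.take u')).counter - (A₂.run c₂ (w.take r')).counter)
    (heq' : ((A₂.run c₂ (w.take u')).counter : ℤ) - (A₂.run c₂ (w.take r')).counter =
      (A₂.run c₂ (w.take u'')).counter - (A₂.run c₂ (w.take r'')).counter) :
    A₁.acceptWeight w c₁ = A₂.acceptWeight w c₂ := by
  have i1 := hc1.u_lt
  have i2 := hc2.u_lt
  have i3 := hc2.u_le
  have i4 := hc2.r_le
  have i5 := hc1.r_le
  have i6 := hc1.r_leE
  have i7 := hc1.E_le
  have hlen : ∀ {a a' s' s : ℕ}, a < a' → a' ≤ s' → s' ≤ s → s ≤ w.length →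
      (w.take a ++ seg w a' s' ++ seg w s w.length).length < w.length := by
    intro a a' s' s h1 h2 h3 h4
    simp only [List.length_append, List.length_take]
    rw [seg_length _ (by omega), seg_length _ le_rfl]
    omega
  obtain ⟨p1, q1⟩ := h.acceptWeight_cut hc1 hY heq
  obtain ⟨p2, q2⟩ := h.acceptWeight_cut hc2 (fun k hk hk' => hY k (by omega) (by omega)) heq'
  obtain ⟨p3, q3⟩ := h.acceptWeight_cut hc3 (fun k hk hk' => hY k (by omega) (by omega))
    (heq.trans heq')
  have e1 := hag _ (hlen i1 hc1.u_le i5 (by omega))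
  have e2 := hag _ (hlen i2 i3 i4 (by omega))
  have e3 := hag _ (hlen hc3.u_lt i3 hc3.r_le (by omega))
  rw [p1, q1] at e1
  rw [p2, q2] at e2
  rw [p3, q3] at e3
  have hu : u ≤ w.length := by omega
  rw [A₁.acceptWeight_eq_factor c₁ w hu, A₂.acceptWeight_eq_factor c₂ w hu]
  have split₁ := fun {i j k : ℕ} (hij : i ≤ j) (hjk : j ≤ k) => A₁.factor_seg c₁ w hij hjk
  have split₂ := fun {i j k : ℕ} (hij : i ≤ j) (hjk : j ≤ k) => A₂.factor_seg c₂ w hij hjk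
  rw [split₁ i2.le (i3.trans i4), split₁ i3 i4, split₂ i2.le (i3.trans i4), split₂ i3 i4] at e1
  rw [A₁.weight_take c₁ w i1.le, A₂.weight_take c₂ w i1.le, split₁ i5 (i6.trans i7),
    split₂ i5 (i6.trans i7)] at e2
  rw [split₁ i1.le (show u' ≤ w.length by omega), split₁ i2.le (show u'' ≤ w.length by omega),
    split₁ i3 (show r'' ≤ w.length by omega), split₁ i4 (show r' ≤ w.length by omega),
    split₁ i5 (i6.trans i7), split₂ i1.le (show u' ≤ w.length by omega),
    split₂ i2.le (show u'' ≤ w.length by omega),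
    split₂ i3 (show r'' ≤ w.length by omega), split₂ i4 (show r' ≤ w.length by omega),
    split₂ i5 (i6.trans i7)]
  refine Eq.trans ?_ ((eq_of_cuts_eq (β := A₁.factor (A₁.run c₁ (w.take u')) (seg w u' u'') *
    A₁.factor (A₁.run c₁ (w.take r'')) (seg w r'' r'))
    (β' := A₂.factor (A₂.run c₂ (w.take u')) (seg w u' u'') *
    A₂.factor (A₂.run c₂ (w.take r'')) (seg w r'' r'))
    (α := A₁.factor (A₁.run c₁ (w.take u)) (seg w u u') *
    A₁.factor (A₁.run c₁ (w.take r')) (seg w r' r))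
    (α' := A₂.factor (A₂.run c₂ (w.take u)) (seg w u u') *
    A₂.factor (A₂.run c₂ (w.take r')) (seg w r' r)) ?_ ?_ e3).trans ?_)
  · ring
  · linear_combination e1
  · linear_combination e2
  · ring

theorem InSync.counter_lt_of_early (h : InSync A₁ A₂ J₁ J₂ K E c₁ c₂) (h0 : c₁.counter = 0)
    (hE : E ≤ w.length) (hhit : A₁.Hit J₁ c₁ (w.take E))
    (hag : ∀ v : List Γ, v.length < w.length → A₁.acceptWeight v c₁ = A₂.acceptWeight v c₂)
    (hw : A₁.acceptWeight w c₁ ≠ A₂.acceptWeight w c₂) {T : ℕ}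
    (hT : ∀ i ≤ T, ∃ v : List Γ, i + v.length < E ∧ A₁.Hit J₁ (A₁.run c₁ (w.take i)) v) :
    (A₁.run c₁ (w.take T)).counter < 6 * K ^ 8 + K ^ 3 + K := by
  classical
  by_contra! hlarge
  obtain ⟨X, hX⟩ : ∃ X : ℕ → ℕ, ∀ i, (A₁.run c₁ (w.take i)).counter = X i := ⟨_, fun _ => rfl⟩
  obtain ⟨Y, hY⟩ : ∃ Y : ℕ → ℕ, ∀ i, (A₂.run c₂ (w.take i)).counter = Y i := ⟨_, fun _ => rfl⟩
  have hXs : ∀ i, X (i + 1) ≤ X i + 1 ∧ X i ≤ X (i + 1) + 1 := fun i => by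
    rw [← hX, ← hX]; exact A₁.counter_take_succ c₁ w i
  have hX0 : X 0 = 0 := by rw [← hX]; simpa using h0
  have hK : 2 ≤ K := by
    have := h.card₁
    have := Fintype.card_pos_iff.2 ⟨c₁.state⟩
    omega
  rw [hX] at hlarge
  have hTE : T < E := by obtain ⟨v, hv, -⟩ := hT T le_rfl; omega
  have hcommon : ∀ i ≤ T, ∃ l : ℕ, l ≤ K * X i + K ^ 3 ∧ l ≤ K * Y i + K ^ 3 ∧
      X i < l + K ∧ Y i < l + K := by
    intro i hi
    obtain ⟨v, hv, hv'⟩ := hT i hi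
    obtain ⟨v', -, -, h1, h2, h3, h4⟩ := h.exists_common hv' (by rw [List.length_take]; omega)
    rw [hX] at h1 h3
    rw [hY] at h2 h4
    exact ⟨_, h1, h2, h3, h4⟩
  -- the levels on the way up
  have hU : ∀ j, ∃ u, K ^ 3 + K ≤ j → j ≤ X T → u ≤ T ∧ X u = j ∧
      (∀ k, u < k → k ≤ T → j < X k) ∧ ∀ k, u ≤ k → k ≤ T → 0 < Y k := by
    intro j
    by_cases hj : K ^ 3 + K ≤ j ∧ j ≤ X T
    swap
    · exact ⟨0, fun h1 h2 => absurd ⟨h1, h2⟩ hj⟩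
    -- The last time a up to T at which some counter vanishes: there the distance is at most K^3, so
    -- the first counter is still below every level considered.
    have ha := Nat.findGreatest_spec (P := fun i => X i = 0 ∨ Y i = 0) (Nat.zero_le T)
      (Or.inl hX0)
    have ha' := fun k hk hk' =>
      Nat.findGreatest_is_greatest (P := fun i => X i = 0 ∨ Y i = 0) (n := T) (k := k) hk hk'
    have haT := Nat.findGreatest_le (P := fun i => X i = 0 ∨ Y i = 0) T
    generalize Nat.findGreatest (fun i => X i = 0 ∨ Y i = 0) T = a at ha ha' haT
    obtain ⟨l, l1, l2, l3, l4⟩ := hcommon a haT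
    have hal : X a < K ^ 3 + K := by
      rcases ha with ha | ha
      · rw [ha] at l1; omega
      · rw [ha] at l2; omega
    obtain ⟨u, h1, h2, h3, h4⟩ := exists_last_level hXs haT (j := j) (by omega) hj.2
    refine ⟨u, fun _ _ => ⟨h2, h3, h4, fun k hk hk' => ?_⟩⟩
    have hak : a < k := by
      rcases h1.eq_or_lt with rfl | h1 <;> omega
    have := ha' k hak hk'
    omega
  choose u hu using hU
  -- the time until which the second counter is positive
  have hXE : X E < K := by rw [← hX]; exact h.lt₁ _ _ hhit.2
  have hbex : ∃ i, T ≤ i ∧ ((∃ v : List Γ, v.length ≤ K ^ 3 ∧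
      A₁.Hit J₁ (A₁.run c₁ (w.take i)) v) ∨ Y i = 0) :=
    ⟨E, hTE.le, Or.inl ⟨[], by simp, hit_append.1 (by simpa using hhit)⟩⟩
  -- Before b all zero tests of the second automaton are controlled: its counter is positive, and a
  -- hit is more than K^3 letters away, as `cut_end` needs.
  obtain ⟨b, ⟨hTb, hb⟩, hbE, hbmin⟩ : ∃ b, (T ≤ b ∧ ((∃ v : List Γ, v.length ≤ K ^ 3 ∧
      A₁.Hit J₁ (A₁.run c₁ (w.take b)) v) ∨ Y b = 0)) ∧ b ≤ E ∧
      ∀ k, T ≤ k → k < b → (∀ v : List Γ, v.length ≤ K ^ 3 →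
        ¬ A₁.Hit J₁ (A₁.run c₁ (w.take k)) v) ∧ 0 < Y k := by
    refine ⟨Nat.find hbex, Nat.find_spec hbex, Nat.find_min' hbex
      ⟨hTE.le, Or.inl ⟨[], by simp, hit_append.1 (by simpa using hhit)⟩⟩, fun k hk hk' => ?_⟩
    have := Nat.find_min hbex hk'
    push Not at this
    have := this hk
    exact ⟨this.1, Nat.pos_of_ne_zero this.2⟩
  -- the levels on the way down
  have hR : ∀ j, ∃ r, K ^ 3 + K ≤ j → j ≤ X T → T ≤ r ∧ r ≤ E ∧ X r = j ∧
      ∀ k, T ≤ k → k < r → j < X k := by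
    intro j
    by_cases hj : K ^ 3 + K ≤ j ∧ j ≤ X T
    · obtain ⟨r, hr⟩ := exists_first_level hXs hTE.le (j := j) hj.2 (by omega)
      exact ⟨r, fun _ _ => hr⟩
    · exact ⟨0, fun h1 h2 => absurd ⟨h1, h2⟩ hj⟩
  choose r hr using hR
  let φ : ℕ → (Q₁ × Q₂) × Q₁ × Q₂ := fun j =>
    (((A₁.run c₁ (w.take (u j))).state, (A₂.run c₂ (w.take (u j))).state),
      (A₁.run c₁ (w.take (r j))).state, (A₂.run c₂ (w.take (r j))).state)
  have hφ : Fintype.card ((Q₁ × Q₂) × Q₁ × Q₂) ≤ K ^ 4 := by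
    have h1 := h.card₁.le
    have h2 := h.card₂.le
    simp only [Fintype.card_prod]
    calc _ ≤ (K * K) * (K * K) := by gcongr
      _ = K ^ 4 := by ring
  have hcut : ∀ j j', K ^ 3 + K ≤ j → j < j' → j' ≤ X T → φ j = φ j' →
      CutPoints A₁ A₂ J₁ K E c₁ c₂ w (u j) (u j') (r j') (r j) := by
    intro j j' hj hjj' hj' hφj
    obtain ⟨u1, u2, u3, -⟩ := hu j hj (by omega)
    obtain ⟨u1', u2', u3', -⟩ := hu j' (by omega) hj'
    obtain ⟨r1, r2, r3, r4⟩ := hr j hj (by omega)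
    obtain ⟨r1', r2', r3', r4'⟩ := hr j' (by omega) hj'
    simp only [φ, Prod.mk.injEq] at hφj
    have hlt : u j < u j' := by
      by_contra! hle
      rcases hle.eq_or_lt with h' | h'
      · rw [h'] at u2'; omega
      · have := u3' _ h' u1; omega
    have hle : r j' ≤ r j := by
      by_contra! hlt
      have := r4' _ r1 hlt; omega
    exact ⟨hlt, u1'.trans r1', hle, r2, hE, hφj.1.1, hφj.1.2, hφj.2.1.symm, hφj.2.2.symm,
      by rw [hX, hX, u2, r3], by rw [hX, hX, u2', r3'], by rw [hX, u2]; exact hj,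
      by rw [hX, hX, u2, u2']; exact hjj'.le, fun k hk hk' => by
        rw [hX, hX, u2']
        rcases hk.eq_or_lt with rfl | hk
        · exact u2'.ge
        · rcases le_total k T with hkT | hkT
          · exact (u3' k hk hkT).le
          · rcases hk'.eq_or_lt with rfl | hk'
            · exact r3'.ge
            · exact (r4' k hkT hk').le, hhit⟩
  have hYpos : ∀ j, K ^ 3 + K ≤ j → j ≤ X T → ∀ k, u j ≤ k → k < b →
      0 < (A₂.run c₂ (w.take k)).counter := by
    intro j hj hj' k hk hk'
    rw [hY]
    rcases le_total k T with hkT | hkT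
    · exact (hu j hj hj').2.2.2 k hk hkT
    · exact (hbmin k hkT hk').2
  have hend : ∀ j j', K ^ 3 + K ≤ j → j < j' → j' ≤ X T → φ j = φ j' → r j ≤ b →
      ∀ v, A₁.Hit J₁ (A₁.run c₁ (w.take b)) v → b + v.length ≤ E →
      ∃ (v' : List Γ) (y : ℕ), A₁.Hit J₁ (A₁.run c₁ (w.take b)) v' ∧ v'.length ≤ v.length ∧
        v'.length ≤ K * y + K ^ 3 ∧ y < v'.length + K ∧
        (y : ℤ) = Y b + (((Y (u j) : ℤ) - Y (r j)) - ((Y (u j') : ℤ) - Y (r j'))) := by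
    intro j j' hj hjj' hj' hφj hrb v hv hvl
    obtain ⟨v', y, h1, h2, h3, h4, h5⟩ := h.cut_end (hcut j j' hj hjj' hj' hφj) hrb hbE
      (hYpos j' (by omega) hj')
      (fun k hk hk' => (hbmin k ((hr j hj (by omega)).1.trans hk) hk').1) b hrb le_rfl hv hvl
    refine ⟨v', y, h1, h2, h3, h4, ?_⟩
    rw [h5]
    simp only [hY]
    ring
  have hbseg : A₁.Hit J₁ (A₁.run c₁ (w.take b)) (seg w b E) := (hit_seg hbE).2 hhit
  have hbseg' : b + (seg w b E).length = E := by rw [seg_length _ hE]; omega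
  have hK1 : K ^ 3 ≤ K ^ 4 := Nat.pow_le_pow_right (by omega) (by omega)
  have hK2 : 2 * K ^ 3 ≤ K ^ 4 := by
    have : K ^ 4 = K * K ^ 3 := by ring
    rw [this]; exact Nat.mul_le_mul_right _ hK
  have hK3 : 4 * K ≤ K ^ 3 := by
    have : K ^ 3 = K * K * K := by ring
    rw [this]; exact Nat.mul_le_mul_right _ (Nat.mul_le_mul hK hK)
  have hK4 : 4 * K ^ 2 ≤ K ^ 4 := by
    have : K ^ 4 = K * K * K ^ 2 := by ring
    rw [this]; exact Nat.mul_le_mul_right _ (Nat.mul_le_mul hK hK)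
  by_cases hshort : ∃ v : List Γ, v.length ≤ K ^ 3 ∧ A₁.Hit J₁ (A₁.run c₁ (w.take b)) v
  · -- both counters come down together
    obtain ⟨v, hv, hvE, hvh⟩ : ∃ v : List Γ, v.length ≤ K ^ 3 ∧ b + v.length ≤ E ∧
        A₁.Hit J₁ (A₁.run c₁ (w.take b)) v := by
      obtain ⟨v, hv, hv'⟩ := hshort
      -- If v overruns E, the stretch of w from b to E is a hit that is shorter still.
      by_cases hE' : b + v.length ≤ E
      · exact ⟨v, hv, hE', hv'⟩
      · exact ⟨_, by omega, hbseg'.le, hbseg⟩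
    have hXb : X b < K ^ 3 + K := by
      have := hvh.counter_lt h.lt₁
      rw [hX] at this
      omega
    have hrb : ∀ j, K ^ 3 + K ≤ j → j ≤ X T → r j ≤ b := by
      intro j hj hj'
      by_contra! hlt
      have := (hr j hj hj').2.2.2 b hTb hlt
      omega
    obtain ⟨C, hC, hCc, hCφ⟩ := exists_large_class φ hφ (K ^ 3 + K)
    have hCm : ∀ j ∈ C, K ^ 3 + K ≤ j ∧ j ≤ X T := fun j hj => by
      have := Finset.mem_Icc.1 (hC hj); omega
    -- After a cut the second counter at b is Y b + F j - F j'. It lies in [0, K^3 + K), and the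
    -- class has more than 2(K^3 + K) + 1 levels.
    obtain ⟨j, hj, j', hj', j'', hj'', h1, h2, h3, h4⟩ := exists_three_eq (C := C)
      (F := fun j => (Y (u j) : ℤ) - Y (r j)) (y := Y b) (k := K ^ 3 + K)
      (fun j hj j' hj' hjj' => by
        obtain ⟨v', y, g1, g2, g3, g4, g5⟩ := hend j j' (hCm j hj).1 hjj' (hCm j' hj').2
          (hCφ j hj j' hj') (hrb j (hCm j hj).1 (hCm j hj).2) v hvh hvE
        rw [← g5]
        exact ⟨by positivity, by exact_mod_cast (by omega : y < K ^ 3 + K)⟩) (by omega)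
    refine hw (h.acceptWeight_eq_of_cuts hag
      (hcut j j' (hCm j hj).1 h1 (hCm j' hj').2 (hCφ j hj j' hj'))
      (hcut j' j'' (hCm j' hj').1 h2 (hCm j'' hj'').2 (hCφ j' hj' j'' hj''))
      (hcut j j'' (hCm j hj).1 (h1.trans h2) (hCm j'' hj'').2 (hCφ j hj j'' hj''))
      (fun k hk hk' => hYpos j' (hCm j' hj').1 (hCm j' hj').2 k hk
        (hk'.trans_le (hrb j' (hCm j' hj').1 (hCm j' hj').2))) ?_ ?_)
    · simpa only [hY] using h3
    · simpa only [hY] using h4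
  · -- the second counter vanishes first
    have hYb : Y b = 0 := hb.resolve_left hshort
    have hDex : ∃ n, ∃ v : List Γ, v.length = n ∧ A₁.Hit J₁ (A₁.run c₁ (w.take b)) v :=
      ⟨_, _, rfl, hbseg⟩
    obtain ⟨D, ⟨v, hvD, hvh⟩, hDmin⟩ : ∃ D, (∃ v : List Γ, v.length = D ∧
        A₁.Hit J₁ (A₁.run c₁ (w.take b)) v) ∧
        ∀ v : List Γ, A₁.Hit J₁ (A₁.run c₁ (w.take b)) v → D ≤ v.length :=
      ⟨Nat.find hDex, Nat.find_spec hDex, fun v hv => Nat.find_min' hDex ⟨v, rfl, hv⟩⟩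
    have hDE := hDmin _ hbseg
    have hDK : K ^ 3 < D := by
      by_contra! hle
      exact hshort ⟨v, by omega, hvh⟩
    -- The height 6K^8 holds two windows of levels. After a dip to the lower window, the upper
    -- levels have been crossed downwards before b; without a dip, the lower ones are crossed only
    -- later.
    by_cases hdip : ∃ i, T ≤ i ∧ i ≤ b ∧ X i ≤ K ^ 3 + K + 3 * K ^ 8
    · obtain ⟨i, hTi, hib, hXi⟩ := hdip
      have hrb : ∀ j, K ^ 3 + K + 3 * K ^ 8 ≤ j → j ≤ X T → r j ≤ b := by
        intro j hj hj'
        by_contra! hlt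
        have := (hr j (by omega) hj').2.2.2 i hTi (by omega)
        omega
      obtain ⟨C, hC, hCc, hCφ⟩ := exists_large_class φ hφ (K ^ 3 + K + 3 * K ^ 8)
      have hCm : ∀ j ∈ C, K ^ 3 + K + 3 * K ^ 8 ≤ j ∧ j ≤ X T := fun j hj => by
        have := Finset.mem_Icc.1 (hC hj); omega
      have hpair : ∀ j ∈ C, ∀ j' ∈ C, j < j' → ∃ y : ℕ, D ≤ K * y + K ^ 3 ∧ y < D + K ∧
          (y : ℤ) = ((Y (u j) : ℤ) - Y (r j)) - ((Y (u j') : ℤ) - Y (r j')) := by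
        intro j hj j' hj' hjj'
        obtain ⟨v', y, g1, g2, g3, g4, g5⟩ := hend j j' (by have := hCm j hj; omega) hjj'
          (hCm j' hj').2 (hCφ j hj j' hj') (hrb j (hCm j hj).1 (hCm j hj).2) v hvh (by omega)
        have := hDmin v' g1
        exact ⟨y, by omega, by omega, by rw [g5, hYb]; simp⟩
      have hmex : ∃ m, D ≤ K * m + K ^ 3 := ⟨D, by nlinarith⟩
      obtain ⟨m, hm, hmin⟩ : ∃ m, D ≤ K * m + K ^ 3 ∧ ∀ y, D ≤ K * y + K ^ 3 → m ≤ y :=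
        ⟨Nat.find hmex, Nat.find_spec hmex, fun y hy => Nat.find_min' hmex hy⟩
      have hm0 : 1 ≤ m := by
        by_contra! hm0
        obtain rfl : m = 0 := by omega
        omega
      -- Each gap changes F by at least m, so 3K^4 gaps give y ≥ 3K^4 m, while y < D + K ≤ K m + K^3
      -- + K.
      obtain ⟨j, hj, j', hj', hjj', -, hle⟩ := exists_mul_le_sub (C := C)
        (F := fun j => (Y (u j) : ℤ) - Y (r j)) (m := m) (fun j hj j' hj' hjj' => by
          obtain ⟨y, y1, y2, y3⟩ := hpair j hj j' hj' hjj'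
          rw [← y3]
          exact_mod_cast hmin y y1) hCc (by positivity)
      obtain ⟨y, y1, y2, y3⟩ := hpair j hj j' hj' hjj'
      rw [← y3] at hle
      have hle' : 3 * K ^ 4 * m ≤ y := by exact_mod_cast hle
      have e1 : (K + (K ^ 3 + K)) * m ≤ 3 * K ^ 4 * m := Nat.mul_le_mul_right _ (by omega)
      have e2 : K ^ 3 + K ≤ (K ^ 3 + K) * m := Nat.le_mul_of_pos_right _ hm0
      rw [add_mul] at e1
      omega
    · push Not at hdip
      have hbr : ∀ j, K ^ 3 + K ≤ j → j ≤ K ^ 3 + K + 3 * K ^ 8 → b ≤ r j := by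
        intro j hj hj'
        by_contra! hlt
        obtain ⟨r1, -, r3, -⟩ := hr j hj (by omega)
        have := hdip (r j) r1 hlt.le
        omega
      obtain ⟨C, hC, hCc, hCφ⟩ := exists_large_class φ hφ (K ^ 3 + K)
      have hCm : ∀ j ∈ C, K ^ 3 + K ≤ j ∧ j ≤ K ^ 3 + K + 3 * K ^ 8 ∧ j ≤ X T := fun j hj => by
        have := Finset.mem_Icc.1 (hC hj); omega
      -- Only the ascending cut precedes b. Since Y b = 0, the shift alone is the new second
      -- counter, and it must match a first counter of at least j.
      have hpair : ∀ j ∈ C, ∀ j' ∈ C, j < j' → ∃ y : ℕ, 0 < y ∧ j < K * y + K ^ 3 + K ∧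
          (y : ℤ) = (Y (u j) : ℤ) - Y (u j') := by
        intro j hj j' hj' hjj'
        obtain ⟨a1, a2, a3⟩ := hCm j hj
        obtain ⟨a1', a2', a3'⟩ := hCm j' hj'
        obtain ⟨-, g2, -, l, g3, g4, g5⟩ := h.cut_mid (hcut j j' a1 hjj' a3' (hCφ j hj j' hj'))
          (hbr j' a1' a2') (hYpos j' a1' a3') b ((hu j' a1' a3').1.trans hTb) le_rfl
        rw [hX, (hu j a1 a3).2.1] at g3
        simp only [hY, hYb] at g2
        exact ⟨_, g5, by omega, by simpa using g2⟩
      have hne : C.Nonempty := Finset.card_pos.1 (by omega)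
      have hmex : ∃ m : ℕ, 0 < m ∧ C.min' hne < K * m + K ^ 3 + K :=
        ⟨C.min' hne + 1, by omega, by nlinarith⟩
      obtain ⟨m, ⟨hm0, hm⟩, hmin⟩ : ∃ m, (0 < m ∧ C.min' hne < K * m + K ^ 3 + K) ∧
          ∀ y, 0 < y → C.min' hne < K * y + K ^ 3 + K → m ≤ y :=
        ⟨Nat.find hmex, Nat.find_spec hmex, fun y hy hy' => Nat.find_min' hmex ⟨hy, hy'⟩⟩
      obtain ⟨j, hj, j', hj', hjj', hjmin, hle⟩ := exists_mul_le_sub (C := C)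
        (F := fun j => (Y (u j) : ℤ)) (m := m) (fun j hj j' hj' hjj' => by
          obtain ⟨y, y1, y2, y3⟩ := hpair j hj j' hj' hjj'
          rw [← y3]
          exact_mod_cast hmin y y1 ((C.min'_le j hj).trans_lt y2)) hCc (by positivity)
      obtain ⟨a1, -, a3⟩ := hCm j hj
      -- The linear tie at time u j bounds Y (u j) from above in terms of j, hence of m, against the
      -- lower bound 3K^4 m.
      obtain ⟨l, l1, -, -, l4⟩ := hcommon (u j) (hu j a1 a3).1
      rw [(hu j a1 a3).2.1] at l1
      have hjm := (hjmin _ (C.min'_mem hne)).trans_lt hm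
      have hle' : 3 * K ^ 4 * m ≤ Y (u j) := by
        have : ((3 * K ^ 4 : ℕ) : ℤ) * m ≤ Y (u j) := by omega
        exact_mod_cast this
      have e1 : K * j ≤ K * (K * m + K ^ 3 + K) := Nat.mul_le_mul_left _ hjm.le
      have e2 : K * (K * m + K ^ 3 + K) = K ^ 2 * m + K ^ 4 + K ^ 2 := by ring
      have e3 : (K ^ 2 + (K ^ 4 + K ^ 2 + K ^ 3 + K)) * m ≤ 3 * K ^ 4 * m :=
        Nat.mul_le_mul_right _ (by omega)
      have e4 : K ^ 4 + K ^ 2 + K ^ 3 + K ≤ (K ^ 4 + K ^ 2 + K ^ 3 + K) * m :=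
        Nat.le_mul_of_pos_right _ hm0
      rw [add_mul] at e3
      omega

end Main

/-! ### Assembling the bound for minimal witnesses -/

section Final

variable {Γ S Q Q₁ Q₂ V : Type*} [Field S]

/-- Incompatibility is invariant under nonzero scaling, so it can be expressed by state and counter
value alone. -/
theorem hit_incompatible_iff (A : DWROCA Γ S Q) {δ : V → Γ → V × S} {η : V → S} {ι : Q → V} {K : ℕ}
    (hδ : ∀ q a, δ (ι q) a = (ι (A.δ₁ q a).1, (A.δ₁ q a).2.2)) (hη : ∀ q, η (ι q) = A.out q)
    {c : Config S Q} {p : List Γ} :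
    A.Hit (fun q n => Incompatible δ η K fun v => A.acceptWeight v ⟨q, n, 1⟩) c p ↔
      Incompatible δ η K fun v => A.acceptWeight v (A.run c p) := by
  constructor
  · intro h
    exact (h.2.smul h.1).congr fun v _ => (A.acceptWeight_eq _ v).symm
  · intro h
    have hne := (h.counter_lt_and_weight_ne_zero A hδ hη).2
    refine ⟨hne, (h.smul (inv_ne_zero hne)).congr fun v _ => ?_⟩
    rw [A.acceptWeight_eq (A.run c p), inv_mul_cancel_left₀ hne]

variable [Fintype Q₁] [Fintype Q₂]
  {A₁ : DWROCA Γ S Q₁} {A₂ : DWROCA Γ S Q₂} {J₁ : Q₁ → ℕ → Prop} {J₂ : Q₂ → ℕ → Prop}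
  {K E : ℕ} {c₁ : Config S Q₁} {c₂ : Config S Q₂} {w : List Γ}

theorem InSync.counter_le_P₃ (h : InSync A₁ A₂ J₁ J₂ K E c₁ c₂) (h₁ : c₁.counter = 0)
    (h₂ : c₂.counter = 0) (hE : w.length = E + K) (hhit : A₁.Hit J₁ c₁ (w.take E))
    (hag : ∀ v : List Γ, v.length < w.length → A₁.acceptWeight v c₁ = A₂.acceptWeight v c₂)
    (hw : A₁.acceptWeight w c₁ ≠ A₂.acceptWeight w c₂) {i : ℕ} (hi : i ≤ w.length) :
    (A₁.run c₁ (w.take i)).counter ≤ P₃ K ∧ (A₂.run c₂ (w.take i)).counter ≤ P₃ K := by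
  classical
  have hK : 1 ≤ K := by have := h.card₁; omega
  -- One half bounds the second counter at the exit position e, the other the number of letters left
  -- after e.
  have hP : 2 * (K * (6 * K ^ 8 + K ^ 3 + K) + K ^ 3 + K) + 1 ≤ P₃ K := by
    have e1 : K ^ 9 ≤ K ^ 12 := Nat.pow_le_pow_right hK (by omega)
    have e2 : K ^ 4 ≤ K ^ 6 := Nat.pow_le_pow_right hK (by omega)
    have e3 : K ^ 3 ≤ K ^ 6 := Nat.pow_le_pow_right hK (by omega)
    have e4 : K ^ 2 ≤ K ^ 6 := Nat.pow_le_pow_right hK (by omega)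
    have e5 : K ^ 1 ≤ K ^ 6 := Nat.pow_le_pow_right hK (by omega)
    have e6 : P₃ K = 14 * K ^ 6 + 72 * K ^ 12 + 1 := by unfold P₃ P₁ P₂; ring
    have e7 : 2 * (K * (6 * K ^ 8 + K ^ 3 + K) + K ^ 3 + K) =
        12 * K ^ 9 + 2 * K ^ 4 + 2 * K ^ 3 + 2 * K ^ 2 + 2 * K ^ 1 := by ring
    omega
  -- From e on no hit ends before E, so the shortest hit from e has length at least E - e; its
  -- linear bound limits the rest of w.
  have hex : ∃ e, ¬ ∃ v : List Γ, e + v.length < E ∧ A₁.Hit J₁ (A₁.run c₁ (w.take e)) v :=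
    ⟨E, fun ⟨v, hv, _⟩ => by omega⟩
  obtain ⟨e, he, hemin⟩ : ∃ e, (¬ ∃ v : List Γ, e + v.length < E ∧
      A₁.Hit J₁ (A₁.run c₁ (w.take e)) v) ∧ ∀ i < e, ∃ v : List Γ, i + v.length < E ∧
      A₁.Hit J₁ (A₁.run c₁ (w.take i)) v :=
    ⟨Nat.find hex, Nat.find_spec hex, fun i hi => not_not.1 (Nat.find_min hex hi)⟩
  have heE : e ≤ E := by
    by_contra! hlt
    obtain ⟨v, hv, -⟩ := hemin E hlt
    omega
  have hearly : ∀ i < e, (A₁.run c₁ (w.take i)).counter < 6 * K ^ 8 + K ^ 3 + K ∧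
      (A₂.run c₂ (w.take i)).counter < K * (6 * K ^ 8 + K ^ 3 + K) + K ^ 3 + K := by
    intro i hi
    have h1 := h.counter_lt_of_early h₁ (by omega) hhit hag hw (T := i)
      fun k hk => hemin k (by omega)
    obtain ⟨v, hv, hv'⟩ := hemin i hi
    obtain ⟨v', -, -, g1, -, -, g4⟩ := h.exists_common hv' (by rw [List.length_take]; omega)
    have := Nat.mul_le_mul_left K h1.le
    exact ⟨h1, by omega⟩
  have hKM : 6 * K ^ 8 + K ^ 3 + K ≤ K * (6 * K ^ 8 + K ^ 3 + K) := Nat.le_mul_of_pos_left _ hK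
  have hexit : (A₁.run c₁ (w.take e)).counter ≤ 6 * K ^ 8 + K ^ 3 + K ∧
      (A₂.run c₂ (w.take e)).counter ≤ K * (6 * K ^ 8 + K ^ 3 + K) + K ^ 3 + K := by
    rcases Nat.eq_zero_or_pos e with rfl | hpos
    · simp [h₁, h₂]
    · obtain ⟨k, rfl⟩ : ∃ k, e = k + 1 := ⟨e - 1, by omega⟩
      have h1 := hearly k (by omega)
      have h2 := A₁.counter_take_succ c₁ w k
      have h3 := A₂.counter_take_succ c₂ w k
      omega
  obtain ⟨v, hv, -, hvl⟩ := ((hit_seg heE).2 hhit).exists_short h.lt₁ h.card₁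
  have hEe : E ≤ e + v.length := by
    by_contra! hlt
    exact he ⟨v, hlt, hv⟩
  have := Nat.mul_le_mul_left K hexit.1
  rcases lt_or_ge i e with hie | hie
  · have := hearly i hie
    omega
  · have h1 := (A₁.run_counter_le (A₁.run c₁ (w.take e)) (seg w e i)).1
    have h2 := (A₂.run_counter_le (A₂.run c₂ (w.take e)) (seg w e i)).1
    rw [run_take_seg _ _ _ hie, seg_length _ hi] at h1 h2
    omega

theorem minimalWitness_counter_le (A₁ : DWROCA Γ S Q₁) (A₂ : DWROCA Γ S Q₂) {w : List Γ}
    (hw : IsMinimalWitness A₁ A₂ A₁.initConfig A₂.initConfig w) {i : ℕ} (hi : i ≤ w.length) :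
    (A₁.run A₁.initConfig (w.take i)).counter ≤ P₃ (Fintype.card Q₁ + Fintype.card Q₂) ∧
      (A₂.run A₂.initConfig (w.take i)).counter ≤ P₃ (Fintype.card Q₁ + Fintype.card Q₂) := by
  obtain ⟨hw, hmin⟩ := hw
  have hag : ∀ v : List Γ, v.length < w.length →
      A₁.acceptWeight v A₁.initConfig = A₂.acceptWeight v A₂.initConfig := by
    intro v hv
    by_contra hne
    have := hmin v hne
    omega
  have hc₁ : 0 < Fintype.card Q₁ := Fintype.card_pos_iff.2 ⟨A₁.initState⟩
  have hc₂ : 0 < Fintype.card Q₂ := Fintype.card_pos_iff.2 ⟨A₂.initState⟩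
  obtain ⟨K, hK⟩ : ∃ K, Fintype.card Q₁ + Fintype.card Q₂ = K := ⟨_, rfl⟩
  rw [hK]
  rcases lt_or_ge w.length K with hlen | hlen
  · have h1 := (A₁.run_counter_le A₁.initConfig (w.take i)).1
    have h2 := (A₂.run_counter_le A₂.initConfig (w.take i)).1
    have h3 : K ≤ P₃ K := by
      have : K ≤ K ^ 6 := Nat.le_self_pow (by omega) K
      unfold P₃ P₁
      omega
    have e1 : A₁.initConfig.counter = 0 := rfl
    have e2 : A₂.initConfig.counter = 0 := rfl
    rw [List.length_take] at h1 h2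
    omega
  obtain ⟨E, hE⟩ := Nat.exists_eq_add_of_le' hlen
  let J₁ : Q₁ → ℕ → Prop := fun q n =>
    Incompatible (sumδ A₁ A₂) (sumη A₁ A₂) K fun v => A₁.acceptWeight v ⟨q, n, 1⟩
  let J₂ : Q₂ → ℕ → Prop := fun q n =>
    Incompatible (sumδ A₁ A₂) (sumη A₁ A₂) K fun v => A₂.acceptWeight v ⟨q, n, 1⟩
  have hit₁ : ∀ p, A₁.Hit J₁ A₁.initConfig p ↔ Incompatible (sumδ A₁ A₂) (sumη A₁ A₂) K
      fun v => A₁.acceptWeight v (A₁.run A₁.initConfig p) := fun p =>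
    A₁.hit_incompatible_iff (ι := Sum.inl) (fun _ _ => rfl) (fun _ => rfl)
  have hit₂ : ∀ p, A₂.Hit J₂ A₂.initConfig p ↔ Incompatible (sumδ A₁ A₂) (sumη A₁ A₂) K
      fun v => A₂.acceptWeight v (A₂.run A₂.initConfig p) := fun p =>
    A₂.hit_incompatible_iff (ι := Sum.inr) (fun _ _ => rfl) (fun _ => rfl)
  have hsync : InSync A₁ A₂ J₁ J₂ K E A₁.initConfig A₂.initConfig := by
    refine ⟨fun q n hJ => (Incompatible.counter_lt_and_weight_ne_zero A₁ (ι := Sum.inl)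
      (fun _ _ => rfl) (fun _ => rfl) hJ).1, fun q n hJ =>
      (Incompatible.counter_lt_and_weight_ne_zero A₂ (ι := Sum.inr)
      (fun _ _ => rfl) (fun _ => rfl) hJ).1, by omega, by omega, fun p hp => ?_⟩
    have hpv : ∀ v : List Γ, v.length ≤ K → A₁.acceptWeight v (A₁.run A₁.initConfig p) =
        A₂.acceptWeight v (A₂.run A₂.initConfig p) := by
      intro v hv
      rw [← acceptWeight_append, ← acceptWeight_append]
      exact hag _ (by rw [List.length_append]; omega)
    rw [hit₁, hit₂]
    exact ⟨fun h => h.congr hpv, fun h => h.congr fun v hv => (hpv v hv).symm⟩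
  -- Otherwise both configurations at E imitate states of `sumδ` on the last K letters.
  have hend : A₁.Hit J₁ A₁.initConfig (w.take E) ∨ A₂.Hit J₂ A₂.initConfig (w.take E) := by
    rw [hit₁, hit₂]
    by_contra! hcon
    obtain ⟨hcon₁, hcon₂⟩ := hcon
    simp only [Incompatible] at hcon₁ hcon₂
    push Not at hcon₁ hcon₂
    obtain ⟨q₁, s₁, hq₁⟩ := hcon₁
    obtain ⟨q₂, s₂, hq₂⟩ := hcon₂
    have hfin := finVal_eq_of_short (sumδ A₁ A₂) (sumη A₁ A₂) (q := q₁) (q' := q₂) (s := s₁)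
      (s' := s₂) (fun v hv => by
        rw [Fintype.card_sum, hK] at hv
        rw [← hq₁ v hv.le, ← hq₂ v hv.le, ← acceptWeight_append, ← acceptWeight_append]
        exact hag _ (by rw [List.length_append, List.length_take]; omega))
    apply hw
    have hl : (w.drop E).length ≤ K := by rw [List.length_drop]; omega
    rw [← List.take_append_drop E w, acceptWeight_append, acceptWeight_append, hq₁ _ hl, hq₂ _ hl,
      hfin]
  rcases hend with hend | hend
  · exact hsync.counter_le_P₃ rfl rfl hE hend hag hw hi
  · have hsync' : InSync A₂ A₁ J₂ J₁ K E A₂.initConfig A₁.initConfig :=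
      ⟨hsync.lt₂, hsync.lt₁, hsync.card₂, hsync.card₁, fun p hp => (hsync.sync p hp).symm⟩
    exact (hsync'.counter_le_P₃ rfl rfl hE hend (fun v hv => (hag v hv).symm) (Ne.symm hw) hi).symm

theorem P₃_isBigO :
    (fun K : ℕ => (P₃ K : ℝ)) =O[Filter.atTop] (fun K : ℕ => (K : ℝ) ^ 12) := by
  refine Asymptotics.IsBigO.of_bound 87 ?_
  filter_upwards [Filter.eventually_ge_atTop 1] with K hK
  have h : P₃ K ≤ 87 * K ^ 12 := by
    have e1 : K ^ 6 ≤ K ^ 12 := Nat.pow_le_pow_right hK (by omega)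
    have e2 : 1 ≤ K ^ 12 := Nat.one_le_pow _ _ hK
    have e3 : P₃ K = 14 * K ^ 6 + 72 * K ^ 12 + 1 := by unfold P₃ P₁ P₂; ring
    omega
  rw [Real.norm_of_nonneg (by positivity), Real.norm_of_nonneg (by positivity)]
  exact_mod_cast h

end Final

end DWROCA

theorem mainTheorem1 {Γ S Q₁ Q₂ : Type*} [Field S] [Fintype Q₁] [Fintype Q₂]
    (A₁ : DWROCA Γ S Q₁) (A₂ : DWROCA Γ S Q₂) :
    (fun K : ℕ => (DWROCA.P₃ K : ℝ)) =O[Filter.atTop] (fun K : ℕ => (K : ℝ) ^ 12) ∧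
    (¬ DWROCA.ConfigEquiv A₁ A₂ A₁.initConfig A₂.initConfig →
      ∀ w : List Γ, DWROCA.IsMinimalWitness A₁ A₂ A₁.initConfig A₂.initConfig w →
        ∀ i ≤ w.length,
          (DWROCA.runPair A₁ A₂ A₁.initConfig A₂.initConfig w i).1.counter
              ≤ DWROCA.P₃ (A₁.size + A₂.size) ∧
          (DWROCA.runPair A₁ A₂ A₁.initConfig A₂.initConfig w i).2.counter
              ≤ DWROCA.P₃ (A₁.size + A₂.size)) :=
  ⟨DWROCA.P₃_isBigO, fun _ _ hw _ hi => DWROCA.minimalWitness_counter_le A₁ A₂ hw hi⟩
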